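/- Let $\alpha\ge 1$ and $\beta$ be real numbers, let $1<c<\frac{12}{11}$, put $\gamma=1/c$, and let $\varepsilon>0$. For an integer $q\ge1$, an integer $a$ and real $x$, let $$\pi(x;q,a)=\#\{p\le x:\ p \text{ prime},\ p\equiv a \pmod q\},$$ and let $\pi_{\alpha,\beta,c}(x;q,a)$ be the number of primes $p\le x$ with $p\equiv a\pmod q$ such that $p=\lfloor \alpha n^c+\beta\rfloor$ for some integer $n\ge1$. Then there is a constant $C>0$, depending only on $\alpha,\beta,c$ and $\varepsilon$, such that for all coprime integers $a,q$ with $q\ge1$ and all real $x\ge2$, $$\left|\pi_{\alpha,\beta,c}(x;q,a)-\alpha^{-\gamma}\gamma x^{\gamma-1}\pi(x;q,a)-\alpha^{-\gamma}\gamma(1-\gamma)\int_2^x u^{\gamma-2}\pi(u;q,a)\,du\right|\le C\,x^{7\gamma/13+11/26+\varepsilon}.$$ -/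

import Mathlib

/-- The set of terms of the generalized Piatetski-Shapiro sequence
`⌊α n ^ c + β⌋`, `n = 1, 2, 3, …`. -/
def genPiatetskiShapiro (α β c : ℝ) : Set ℤ :=
  {m : ℤ | ∃ n : ℕ, 1 ≤ n ∧ m = ⌊α * (n : ℝ) ^ c + β⌋}

/-- `π(x; q, a)`: the number of primes `p ≤ x` with `p ≡ a (mod q)`. -/
noncomputable def primeCountAP (x : ℝ) (q : ℕ) (a : ℤ) : ℕ :=
  Set.ncard {p : ℕ | p.Prime ∧ (p : ℝ) ≤ x ∧ (p : ℤ) ≡ a [ZMOD (q : ℤ)]}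

/-- `π_{α,β,c}(x; q, a)`: the number of primes `p ≤ x` with `p ≡ a (mod q)` that occur in the
generalized Piatetski-Shapiro sequence. -/
noncomputable def primeCountGPS (α β c x : ℝ) (q : ℕ) (a : ℤ) : ℕ :=
  Set.ncard {p : ℕ | p.Prime ∧ (p : ℝ) ≤ x ∧ (p : ℤ) ∈ genPiatetskiShapiro α β c ∧
    (p : ℤ) ≡ a [ZMOD (q : ℤ)]}

/-!
An integer `n` occurs in the sequence iff `[κ (n - β) ^ γ, κ (n + 1 - β) ^ γ)` contains an integer,
where `κ = α ^ (-γ)`, so its indicator is the increment of `κ u ^ γ`, which partial summation turns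
into the main terms, plus a difference of two sawtooth values. To sum the sawtooth over primes in a
progression, bound it on both sides by difference quotients of the second Bernoulli function, whose
Fourier series converges absolutely. This leaves exponential sums over primes with phase
`h κ (p - β) ^ γ + θ p`, the linear term coming from the additive characters that detect the
residue class; it does not affect second derivatives, so the bounds are uniform in `q`. Vaughan's
identity splits these sums into type I and type II sums, which are estimated with van der Corput's
second derivative test.
-/

namespace PiatetskiShapiro

section ExponentialSums

open Finset Real
open scoped FourierTransform

@[simp]
lemma norm_fourierChar (t : ℝ) : ‖(𝐞 t : ℂ)‖ = 1 := Circle.norm_coe _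

lemma norm_one_sub_fourierChar (t : ℝ) : ‖1 - (𝐞 t : ℂ)‖ = 2 * |sin (π * t)| := by
  rw [norm_sub_rev, fourierChar_apply, mul_comm, Complex.norm_exp_I_mul_ofReal_sub_one, norm_mul,
    norm_two, norm_eq_abs]
  ring_nf

lemma inv_one_sub_fourierChar {t : ℝ} (ht : sin (π * t) ≠ 0) :
    (1 - (𝐞 t : ℂ))⁻¹ = 1 / 2 + ((cot (π * t) / 2 : ℝ) : ℂ) * Complex.I := by
  have hsq : (𝐞 t : ℂ) = (Complex.cos (π * t) + Complex.sin (π * t) * Complex.I) ^ 2 := by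
    rw [fourierChar_apply, ← Complex.exp_mul_I, ← Complex.exp_nat_mul]
    push_cast
    ring_nf
  have hsin : Complex.sin (π * t) ≠ 0 := by exact_mod_cast ht
  have hone := Complex.sin_sq_add_cos_sq (π * t : ℂ)
  apply inv_eq_of_mul_eq_one_right
  rw [hsq]
  push_cast [Complex.cot_eq_cos_div_sin]
  generalize Complex.cos (π * t) = C at *
  generalize Complex.sin (π * t) = S at *
  have hconj : (C + S * Complex.I) * (C - S * Complex.I) = 1 := by
    linear_combination hone - S ^ 2 * Complex.I_sq
  field_simp
  linear_combination (-(C + S * Complex.I) * Complex.I) * hconj +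
    ((1 - (C + S * Complex.I) ^ 2) * S - 2 * S) * Complex.I_sq

lemma antitoneOn_cot : AntitoneOn cot (Set.Ioo 0 π) := by
  intro s hs t ht hst
  rw [cot_eq_cos_div_sin, cot_eq_cos_div_sin,
    div_le_div_iff₀ (sin_pos_of_mem_Ioo ht) (sin_pos_of_mem_Ioo hs)]
  have hsub : 0 ≤ sin (t - s) :=
    sin_nonneg_of_nonneg_of_le_pi (sub_nonneg.mpr hst) (by linarith [hs.1, ht.2])
  rw [sin_sub] at hsub
  linarith

lemma two_mul_abs_sub_intCast_le_abs_sin {t : ℝ} (m : ℤ) (hm : |t - m| ≤ 1 / 2) :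
    2 * |t - m| ≤ |sin (π * t)| := by
  have hshift : |sin (π * (t - m))| = |sin (π * t)| := by
    rw [mul_sub, mul_comm π (m : ℝ), sin_sub_int_mul_pi, abs_mul, abs_neg_one_zpow, one_mul]
  have habs : |π * (t - m)| = π * |t - m| := by rw [abs_mul, abs_of_pos pi_pos]
  calc 2 * |t - m| = 2 / π * |π * (t - m)| := by
        rw [habs]
        field_simp
    _ ≤ |sin (π * (t - m))| := mul_abs_le_abs_sin <| by
        rw [habs]
        nlinarith [pi_pos]
    _ = |sin (π * t)| := hshift

lemma two_mul_le_abs_sin {t η : ℝ} (k : ℤ) (hη : 0 ≤ η) (ht : t ∈ Set.Icc (k + η) (k + 1 - η)) :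
    2 * η ≤ |sin (π * t)| := by
  obtain ⟨hl, hu⟩ := ht
  rcases le_total t (k + 1 / 2) with hk | hk
  · have habs : |t - k| = t - k := abs_of_nonneg (by linarith)
    have := two_mul_abs_sub_intCast_le_abs_sin k (t := t) (by linarith)
    linarith
  · have habs : |t - (k + 1 : ℤ)| = k + 1 - t := by
      push_cast
      rw [abs_of_nonpos (by linarith)]
      ring
    have := two_mul_abs_sub_intCast_le_abs_sin (k + 1) (t := t) (by linarith)
    linarith

lemma norm_sum_Ico_mul_sub_succ_le {R : Type*} [NormedRing R] (c z : ℕ → R) {a m : ℕ} {B : ℝ}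
    (ham : a ≤ m) (hz : ∀ n ∈ Icc a (m + 1), ‖z n‖ ≤ B) :
    ‖∑ n ∈ Ico a (m + 1), c n * (z n - z (n + 1))‖ ≤
      (‖c a‖ + ‖c m‖ + ∑ n ∈ Ico a m, ‖c (n + 1) - c n‖) * B := by
  have hparts : ∑ n ∈ Ico a (m + 1), c n * (z n - z (n + 1)) =
      c a * z a - c m * z (m + 1) + ∑ n ∈ Ico a m, (c (n + 1) - c n) * z (n + 1) := by
    clear hz
    induction m, ham using Nat.le_induction with
    | base => simp [mul_sub]
    | succ k hk ih =>
      rw [sum_Ico_succ_top (by lia), ih, sum_Ico_succ_top hk]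
      noncomm_ring
  have hmul (x : R) {n : ℕ} (hn : n ∈ Icc a (m + 1)) : ‖x * z n‖ ≤ ‖x‖ * B :=
    (norm_mul_le _ _).trans (by gcongr; exact hz n hn)
  calc _ ≤ ‖c a * z a‖ + ‖c m * z (m + 1)‖ + ∑ n ∈ Ico a m, ‖(c (n + 1) - c n) * z (n + 1)‖ := by
        rw [hparts]
        exact (norm_add_le _ _).trans (add_le_add (norm_sub_le _ _) (norm_sum_le _ _))
    _ ≤ ‖c a‖ * B + ‖c m‖ * B + ∑ n ∈ Ico a m, ‖c (n + 1) - c n‖ * B := by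
        gcongr with n hn
        · exact hmul _ (by grind)
        · exact hmul _ (by grind)
        · exact hmul _ (by grind)
    _ = _ := by rw [← sum_mul]; ring

lemma sin_pi_mul_sub_intCast_pos {t : ℝ} {k : ℤ} (ht : t ∈ Set.Ioo (k : ℝ) (k + 1)) :
    0 < sin (π * (t - k)) := by
  apply sin_pos_of_pos_of_lt_pi <;> nlinarith [ht.1, ht.2, pi_pos]

lemma fourierChar_sub_intCast (t : ℝ) (k : ℤ) : (𝐞 (t - k) : ℂ) = 𝐞 t := by
  rw [fourierChar_apply, fourierChar_apply, Complex.exp_eq_exp_iff_exists_int]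
  exact ⟨-k, by push_cast; ring⟩

lemma norm_inv_one_sub_fourierChar_le {t η : ℝ} (k : ℤ) (hη : 0 < η)
    (ht : t ∈ Set.Icc (k + η) (k + 1 - η)) : ‖(1 - (𝐞 t : ℂ))⁻¹‖ ≤ η⁻¹ / 4 := by
  have hsin := two_mul_le_abs_sin k hη.le ht
  calc ‖(1 - (𝐞 t : ℂ))⁻¹‖ = (2 * |sin (π * t)|)⁻¹ := by
        rw [norm_inv, norm_one_sub_fourierChar]
    _ ≤ (2 * (2 * η))⁻¹ := by gcongr
    _ = η⁻¹ / 4 := by ring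

lemma norm_inv_one_sub_fourierChar_sub {s t : ℝ} (k : ℤ) (hs : s ∈ Set.Ioo (k : ℝ) (k + 1))
    (ht : t ∈ Set.Ioo (k : ℝ) (k + 1)) (hst : s ≤ t) :
    ‖(1 - (𝐞 t : ℂ))⁻¹ - (1 - (𝐞 s : ℂ))⁻¹‖ =
      ((1 - (𝐞 s : ℂ))⁻¹).im - ((1 - (𝐞 t : ℂ))⁻¹).im := by
  have hcot {u : ℝ} (hu : u ∈ Set.Ioo (k : ℝ) (k + 1)) : (1 - (𝐞 u : ℂ))⁻¹ =
      1 / 2 + ((cot (π * (u - k)) / 2 : ℝ) : ℂ) * Complex.I := by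
    rw [← inv_one_sub_fourierChar (sin_pi_mul_sub_intCast_pos hu).ne', fourierChar_sub_intCast]
  have him (r : ℝ) : (1 / 2 + (r : ℂ) * Complex.I).im = r := by
    norm_num [Complex.add_im]
  have hanti : cot (π * (t - k)) ≤ cot (π * (s - k)) := by
    apply antitoneOn_cot
    · constructor <;> nlinarith [hs.1, hs.2, pi_pos]
    · constructor <;> nlinarith [ht.1, ht.2, pi_pos]
    · gcongr
  rw [hcot hs, hcot ht, him, him, add_sub_add_left_eq_sub, ← sub_mul, norm_mul, Complex.norm_I,
    mul_one, ← Complex.ofReal_sub, Complex.norm_real, norm_eq_abs, abs_of_nonpos (by linarith),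
    neg_sub]

theorem kusmin_landau {f : ℕ → ℝ} {a b : ℕ} {η : ℝ} (k : ℤ) (hη : 0 < η)
    (hmono : MonotoneOn (fun n ↦ f (n + 1) - f n) (Set.Ico a b))
    (hf : ∀ n ∈ Ico a b, f (n + 1) - f n ∈ Set.Icc (k + η) (k + 1 - η)) :
    ‖∑ n ∈ Ico a b, (𝐞 (f n) : ℂ)‖ ≤ η⁻¹ := by
  rcases Nat.lt_or_ge a b with hab | hab
  swap
  · simp [hab, hη.le]
  obtain ⟨m, rfl⟩ : ∃ m, b = m + 1 := ⟨b - 1, by lia⟩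
  set d : ℕ → ℝ := fun n ↦ f (n + 1) - f n
  set c : ℕ → ℂ := fun n ↦ (1 - (𝐞 (d n) : ℂ))⁻¹
  have hd {n} (hn : n ∈ Ico a (m + 1)) : d n ∈ Set.Ioo (k : ℝ) (k + 1) := by
    constructor <;> linarith [(hf n hn).1, (hf n hn).2]
  have hnorm {n} (hn : n ∈ Ico a (m + 1)) : ‖c n‖ ≤ η⁻¹ / 4 :=
    norm_inv_one_sub_fourierChar_le k hη (hf n hn)
  have hvar : ∑ n ∈ Ico a m, ‖c (n + 1) - c n‖ = (c a).im - (c m).im := by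
    rw [← neg_sub, ← sum_Ico_sub (fun n ↦ (c n).im) (by lia), ← sum_neg_distrib]
    refine sum_congr rfl fun n hn ↦ ?_
    rw [neg_sub]
    exact norm_inv_one_sub_fourierChar_sub k (hd (by grind)) (hd (by grind))
      (hmono (by grind) (by grind) n.le_succ)
  have hterm : ∀ n ∈ Ico a (m + 1),
      (𝐞 (f n) : ℂ) = c n * ((𝐞 (f n) : ℂ) - (𝐞 (f (n + 1)) : ℂ)) := by
    intro n hn
    have hne : 1 - (𝐞 (d n) : ℂ) ≠ 0 := by
      rw [← norm_pos_iff, norm_one_sub_fourierChar]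
      linarith [two_mul_le_abs_sin k hη.le (hf n hn)]
    have hsucc : (𝐞 (f (n + 1)) : ℂ) = 𝐞 (f n) * 𝐞 (d n) := by
      rw [← Circle.coe_mul, ← AddChar.map_add_eq_mul, add_sub_cancel]
    rw [hsucc]
    simp only [c]
    field_simp
  rw [sum_congr rfl hterm]
  refine (norm_sum_Ico_mul_sub_succ_le c (fun n ↦ (𝐞 (f n) : ℂ)) (B := 1) (by lia)
    fun n _ ↦ (norm_fourierChar _).le).trans ?_
  have ha := hnorm (n := a) (by grind)
  have hm := hnorm (n := m) (by grind)
  have hima := (le_abs_self _).trans (Complex.abs_im_le_norm (c a))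
  have himm := (neg_le_abs _).trans (Complex.abs_im_le_norm (c m))
  linarith

lemma mul_sub_le_sub_of_forall_le_sub {d : ℕ → ℝ} {l : ℝ} {m n : ℕ} (hmn : m ≤ n)
    (h : ∀ k ∈ Ico m n, l ≤ d (k + 1) - d k) : l * (n - m) ≤ d n - d m := by
  have := card_nsmul_le_sum _ _ _ h
  rwa [sum_Ico_sub d hmn, Nat.card_Ico, nsmul_eq_mul, Nat.cast_sub hmn, mul_comm] at this

lemma sub_le_mul_sub_of_forall_sub_le {d : ℕ → ℝ} {u : ℝ} {m n : ℕ} (hmn : m ≤ n)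
    (h : ∀ k ∈ Ico m n, d (k + 1) - d k ≤ u) : d n - d m ≤ u * (n - m) := by
  have := sum_le_card_nsmul _ _ _ h
  rwa [sum_Ico_sub d hmn, Nat.card_Ico, nsmul_eq_mul, Nat.cast_sub hmn, mul_comm] at this

lemma card_filter_mem_Icc_le {d : ℕ → ℝ} {a b : ℕ} {l η : ℝ} (u : ℝ) (hl : 0 < l) (hη : 0 ≤ η)
    (hd : ∀ n, a ≤ n → n + 1 < b → l ≤ d (n + 1) - d n) :
    (#{n ∈ Ico a b | d n ∈ Set.Icc u (u + η)} : ℝ) ≤ η / l + 1 := by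
  set s := {n ∈ Ico a b | d n ∈ Set.Icc u (u + η)}
  rcases s.eq_empty_or_nonempty with hempty | hne
  · rw [hempty, card_empty, Nat.cast_zero]
    positivity
  obtain ⟨hm, hdm⟩ := mem_filter.mp (s.min'_mem hne)
  obtain ⟨hn, hdn⟩ := mem_filter.mp (s.max'_mem hne)
  set m := s.min' hne
  set n := s.max' hne
  have hmn : m ≤ n := s.min'_le n (s.max'_mem hne)
  have hcard : #s ≤ n + 1 - m := by
    rw [← Nat.card_Icc]
    exact card_le_card fun k hk ↦ mem_Icc.mpr ⟨s.min'_le k hk, s.le_max' k hk⟩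
  have hgrow := mul_sub_le_sub_of_forall_le_sub hmn fun k hk ↦ hd k (by grind) (by grind)
  calc (#s : ℝ) ≤ (n + 1 - m : ℕ) := by exact_mod_cast hcard
    _ = (n - m : ℝ) + 1 := by rw [Nat.cast_sub (by lia)]; push_cast; ring
    _ ≤ η / l + 1 := by
      gcongr
      rw [le_div_iff₀ hl]
      linarith [hdm.1, hdn.2]

lemma exists_eq_Ico_of_ordConnected {s : Finset ℕ} (hs : (s : Set ℕ).OrdConnected) :
    ∃ a b, s = Ico a b := by
  rcases s.eq_empty_or_nonempty with rfl | hne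
  · exact ⟨0, 0, by simp⟩
  refine ⟨s.min' hne, s.max' hne + 1, Subset.antisymm (fun k hk ↦ ?_) fun k hk ↦ ?_⟩
  · exact mem_Ico.mpr ⟨s.min'_le k hk, Nat.lt_succ_of_le (s.le_max' k hk)⟩
  · rw [mem_Ico, Nat.lt_succ_iff] at hk
    exact hs.out (s.min'_mem hne) (s.max'_mem hne) hk

lemma norm_sum_fourierChar_le_card {ι : Type*} (s : Finset ι) (f : ι → ℝ) :
    ‖∑ i ∈ s, (𝐞 (f i) : ℂ)‖ ≤ #s := by
  simpa using norm_sum_le s fun i ↦ (𝐞 (f i) : ℂ)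

section VanDerCorput

variable {f : ℕ → ℝ} {a b : ℕ} {l : ℝ}

lemma norm_sum_filter_mem_Icc_le_of_monotoneOn {η : ℝ} (k : ℤ) (hη : 0 < η)
    (hmono : MonotoneOn (fun n ↦ f (n + 1) - f n) (Set.Ico a b)) :
    ‖∑ n ∈ Ico a b with f (n + 1) - f n ∈ Set.Icc (k + η) (k + 1 - η), (𝐞 (f n) : ℂ)‖ ≤ η⁻¹ := by
  set s := {n ∈ Ico a b | f (n + 1) - f n ∈ Set.Icc (k + η) (k + 1 - η)} with hs
  have hsub : (s : Set ℕ) ⊆ Set.Ico a b := fun n hn ↦ by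
    simpa using (mem_filter.mp hn).1
  have hconn : (s : Set ℕ).OrdConnected := by
    refine ⟨fun m hm n hn p hp ↦ ?_⟩
    have hp' : p ∈ Set.Ico a b := Set.OrdConnected.out' (hsub hm) (hsub hn) hp
    have hmp := hmono (hsub hm) hp' hp.1
    have hpn := hmono hp' (hsub hn) hp.2
    rw [mem_coe, hs, mem_filter] at hm hn ⊢
    exact ⟨mem_Ico.mpr hp', hm.2.1.trans hmp, hpn.trans hn.2.2⟩
  obtain ⟨a', b', hab'⟩ := exists_eq_Ico_of_ordConnected hconn
  rw [hab'] at hsub ⊢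
  refine kusmin_landau k hη (hmono.mono (by simpa using hsub)) fun n hn ↦ ?_
  rw [← hab'] at hn
  exact (mem_filter.mp hn).2

/- Near an integer the first difference stays only briefly, by its growth; away from the integers
the Kusmin–Landau inequality applies. -/
lemma norm_sum_filter_floor_eq_le (k : ℤ) (hl : 0 < l) (hl' : √l ≤ 1 / 2)
    (hf : ∀ n, a ≤ n → n + 1 < b → l ≤ (f (n + 2) - f (n + 1)) - (f (n + 1) - f n)) :
    ‖∑ n ∈ Ico a b with ⌊f (n + 1) - f n⌋ = k, (𝐞 (f n) : ℂ)‖ ≤ 4 * (√l)⁻¹ := by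
  set d : ℕ → ℝ := fun n ↦ f (n + 1) - f n
  set η := √l
  have hη : 0 < η := sqrt_pos.mpr hl
  have hηl : η / l = η⁻¹ := sqrt_div_self
  have hmono : MonotoneOn d (Set.Ico a b) :=
    monotoneOn_of_le_add_one Set.ordConnected_Ico fun n _ hn hn' ↦
      sub_nonneg.mp (hl.le.trans (hf n hn.1 hn'.2))
  have hlow := card_filter_mem_Icc_le (d := d) (k : ℝ) hl hη.le hf
  have hhigh := card_filter_mem_Icc_le (d := d) (k + 1 - η : ℝ) hl hη.le hf
  have hmid := norm_sum_filter_mem_Icc_le_of_monotoneOn k hη hmono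
  set fiber := {n ∈ Ico a b | ⌊d n⌋ = k} with hfiber
  set low := {n ∈ Ico a b | d n ∈ Set.Icc (k : ℝ) (k + η)} with hlow_def
  set mid := {n ∈ Ico a b | d n ∈ Set.Icc (k + η : ℝ) (k + 1 - η)} with hmid_def
  set high := {n ∈ Ico a b | d n ∈ Set.Icc (k + 1 - η : ℝ) (k + 1 - η + η)} with hhigh_def
  have hmid_sub : mid ⊆ fiber := fun n hn ↦ by
    simp only [hmid_def, hfiber, mem_filter, Set.mem_Icc, Int.floor_eq_iff] at hn ⊢
    exact ⟨hn.1, by linarith, by linarith⟩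
  have hsdiff : fiber \ mid ⊆ low ∪ high := fun n hn ↦ by
    simp only [hlow_def, hhigh_def, hmid_def, hfiber, mem_filter, Set.mem_Icc, Int.floor_eq_iff,
      mem_sdiff, mem_union] at hn ⊢
    grind
  have hcard : (#(fiber \ mid) : ℝ) ≤ #low + #high := by
    exact_mod_cast (card_le_card hsdiff).trans (card_union_le _ _)
  have hinv : 2 ≤ η⁻¹ := by
    rw [le_inv_comm₀ two_pos hη]
    linarith
  have hnear := norm_sum_fourierChar_le_card (fiber \ mid) f
  rw [hηl] at hlow hhigh
  rw [← sum_sdiff hmid_sub]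
  linarith [norm_add_le (∑ n ∈ fiber \ mid, (𝐞 (f n) : ℂ)) (∑ n ∈ mid, (𝐞 (f n) : ℂ))]

lemma card_image_floor_le {d : ℕ → ℝ} {u : ℝ} (hab : a ≤ b) (hu : 0 ≤ u)
    (hmono : MonotoneOn d (Set.Ico a b)) (hd : ∀ n, a ≤ n → n + 1 < b → d (n + 1) - d n ≤ u) :
    (#((Ico a b).image fun n ↦ ⌊d n⌋) : ℝ) ≤ u * (b - a) + 2 := by
  rcases hab.eq_or_lt with rfl | hlt
  · simp
  obtain ⟨m, rfl⟩ : ∃ m, b = m + 1 := ⟨b - 1, by lia⟩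
  have hsub : (Ico a (m + 1)).image (fun n ↦ ⌊d n⌋) ⊆ Icc ⌊d a⌋ ⌊d m⌋ := by
    refine image_subset_iff.mpr fun n hn ↦ mem_Icc.mpr ⟨?_, ?_⟩ <;>
      exact Int.floor_le_floor (hmono (by grind) (by grind) (by grind))
  have hfloor : ⌊d a⌋ ≤ ⌊d m⌋ := Int.floor_le_floor (hmono (by grind) (by grind) (by lia))
  have hvar := sub_le_mul_sub_of_forall_sub_le (d := d) (Nat.lt_succ_iff.mp hlt) fun n hn ↦
    hd n (by grind) (by grind)
  calc (#((Ico a (m + 1)).image fun n ↦ ⌊d n⌋) : ℝ) ≤ #(Icc ⌊d a⌋ ⌊d m⌋) := by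
        exact_mod_cast card_le_card hsub
    _ = (⌊d m⌋ + 1 - ⌊d a⌋ : ℤ) := by
        rw [Int.card_Icc, ← Int.cast_natCast, Int.toNat_of_nonneg (by lia)]
    _ ≤ u * (m - a) + 2 := by
        push_cast
        linarith [Int.floor_le (d m), Int.lt_floor_add_one (d a)]
    _ ≤ _ := by
        gcongr
        simp

theorem van_der_corput {C : ℝ} (hl : 0 < l) (hC : 1 ≤ C) (hab : a ≤ b)
    (hf : ∀ n, a ≤ n → n + 1 < b →
      (f (n + 2) - f (n + 1)) - (f (n + 1) - f n) ∈ Set.Icc l (C * l)) :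
    ‖∑ n ∈ Ico a b, (𝐞 (f n) : ℂ)‖ ≤ 8 * C * ((b - a) * √l + (√l)⁻¹) := by
  have hba : (0 : ℝ) ≤ b - a := by simpa using hab
  have hsqrt : 0 < √l := sqrt_pos.mpr hl
  rcases le_total (1 / 2) (√l) with hlarge | hsmall
  · calc ‖∑ n ∈ Ico a b, (𝐞 (f n) : ℂ)‖ ≤ #(Ico a b) := norm_sum_fourierChar_le_card _ _
      _ = 8 * 1 * ((b - a) * (1 / 8) + 0) := by
        rw [Nat.card_Ico, Nat.cast_sub hab]
        ring
      _ ≤ 8 * C * ((b - a) * √l + (√l)⁻¹) := by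
        gcongr
        · linarith
        · positivity
  set d : ℕ → ℝ := fun n ↦ f (n + 1) - f n
  have hmono : MonotoneOn d (Set.Ico a b) :=
    monotoneOn_of_le_add_one Set.ordConnected_Ico fun n _ hn hn' ↦
      sub_nonneg.mp (hl.le.trans (hf n hn.1 hn'.2).1)
  have hfloors := card_image_floor_le hab (by positivity) hmono fun n h h' ↦ (hf n h h').2
  calc ‖∑ n ∈ Ico a b, (𝐞 (f n) : ℂ)‖
      ≤ ∑ k ∈ (Ico a b).image fun n ↦ ⌊d n⌋, 4 * (√l)⁻¹ := by
        rw [← sum_fiberwise_of_maps_to fun n hn ↦ mem_image_of_mem (fun n ↦ ⌊d n⌋) hn]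
        exact (norm_sum_le _ _).trans <| sum_le_sum fun k _ ↦
          norm_sum_filter_floor_eq_le k hl hsmall fun n h h' ↦ (hf n h h').1
    _ ≤ (C * l * (b - a) + 2) * (4 * (√l)⁻¹) := by
        rw [sum_const, nsmul_eq_mul]
        gcongr
    _ = 4 * C * (b - a) * √l + 8 * (√l)⁻¹ := by
        have : l * (√l)⁻¹ = √l := by rw [← div_eq_mul_inv, div_sqrt]
        linear_combination 4 * C * (b - a) * this
    _ ≤ 8 * C * (b - a) * √l + 8 * C * (√l)⁻¹ := by
        gcongr
        · norm_num
        · linarith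
    _ = _ := by ring

end VanDerCorput

end ExponentialSums

section ArithmeticFunctions

open Finset ArithmeticFunction
open scoped ArithmeticFunction.zeta ArithmeticFunction.Moebius

lemma natCast_add_one_le_two_rpow {ε : ℝ} (hε : 0 < ε) (a : ℕ) :
    (a : ℝ) + 1 ≤ (1 + 1 / (ε * Real.log 2)) * 2 ^ (ε * a) := by
  have := Real.log_pos one_lt_two
  have hexp : 1 + ε * Real.log 2 * a ≤ (2 : ℝ) ^ (ε * a) := by
    rw [Real.rpow_def_of_pos two_pos]
    linarith [Real.add_one_le_exp (Real.log 2 * (ε * a))]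
  calc (a : ℝ) + 1 ≤ (a + 1) + (1 / (ε * Real.log 2) + ε * Real.log 2 * a) :=
        le_add_of_nonneg_right (by positivity)
    _ = (1 + 1 / (ε * Real.log 2)) * (1 + ε * Real.log 2 * a) := by
        field_simp
        ring
    _ ≤ _ := by gcongr

lemma natCast_add_one_le_rpow_of_two_rpow_le {ε p : ℝ} (hε : 0 < ε) (hp : 2 ^ (1 / ε) ≤ p)
    (a : ℕ) : (a : ℝ) + 1 ≤ (p ^ a) ^ ε := by
  have hp0 : 0 ≤ p := (by positivity : (0 : ℝ) ≤ 2 ^ (1 / ε)).trans hp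
  have htwo : 2 ≤ p ^ ε :=
    calc (2 : ℝ) = (2 ^ (1 / ε)) ^ ε := by
          rw [← Real.rpow_mul two_pos.le, one_div_mul_cancel hε.ne', Real.rpow_one]
      _ ≤ p ^ ε := by gcongr
  calc (a : ℝ) + 1 ≤ 2 ^ a := mod_cast Nat.lt_two_pow_self
    _ ≤ (p ^ ε) ^ a := by gcongr
    _ = (p ^ a) ^ ε := by
        rw [← Real.rpow_mul_natCast hp0, mul_comm, Real.rpow_natCast_mul hp0]

lemma prod_factorization_add_one_le {ε : ℝ} (hε : 0 < ε) {n : ℕ} (hn : n ≠ 0) :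
    ∏ p ∈ n.primeFactors, ((n.factorization p : ℝ) + 1) ≤
      (1 + 1 / (ε * Real.log 2)) ^ ⌈(2 : ℝ) ^ (1 / ε)⌉₊ * (n : ℝ) ^ ε := by
  set P : ℕ := ⌈(2 : ℝ) ^ (1 / ε)⌉₊
  set B : ℝ := 1 + 1 / (ε * Real.log 2)
  have := Real.log_pos one_lt_two
  have hB : 1 ≤ B := le_add_of_nonneg_right (by positivity)
  have hlocal {p : ℕ} (hp : p.Prime) (a : ℕ) :
      (a : ℝ) + 1 ≤ (if p < P then B else 1) * ((p : ℝ) ^ a) ^ ε := by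
    split_ifs with h
    · refine (natCast_add_one_le_two_rpow hε a).trans ?_
      rw [← Real.rpow_natCast_mul (by positivity), mul_comm ε (a : ℝ)]
      gcongr
      exact mod_cast hp.two_le
    · rw [one_mul]
      exact natCast_add_one_le_rpow_of_two_rpow_le hε
        ((Nat.le_ceil _).trans (mod_cast not_lt.mp h)) a
  have hfac : ∏ p ∈ n.primeFactors, (p : ℝ) ^ n.factorization p = n :=
    mod_cast (Nat.prod_factorization_eq_prod_primeFactors (· ^ ·)).symm.trans
      (Nat.prod_factorization_pow_eq_self hn)
  calc ∏ p ∈ n.primeFactors, ((n.factorization p : ℝ) + 1)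
      ≤ ∏ p ∈ n.primeFactors, ((if p < P then B else 1) * ((p : ℝ) ^ n.factorization p) ^ ε) :=
        prod_le_prod (fun _ _ ↦ by positivity)
          fun p hp ↦ hlocal (Nat.prime_of_mem_primeFactors hp) _
    _ = (∏ p ∈ n.primeFactors, if p < P then B else 1) * (n : ℝ) ^ ε := by
        rw [prod_mul_distrib, Real.finsetProd_rpow _ _ (fun _ _ ↦ by positivity), hfac]
    _ ≤ B ^ P * (n : ℝ) ^ ε := by
        gcongr
        rw [prod_ite, prod_const, prod_const_one, mul_one]
        exact pow_le_pow_right₀ hB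
          ((card_le_card fun p hp ↦ mem_range.mpr (mem_filter.mp hp).2).trans_eq (card_range P))

theorem exists_card_divisors_le_rpow {ε : ℝ} (hε : 0 < ε) :
    ∃ C : ℝ, 1 ≤ C ∧ ∀ n : ℕ, n ≠ 0 → (#n.divisors : ℝ) ≤ C * (n : ℝ) ^ ε := by
  have := Real.log_pos one_lt_two
  refine ⟨(1 + 1 / (ε * Real.log 2)) ^ ⌈(2 : ℝ) ^ (1 / ε)⌉₊,
    one_le_pow₀ (le_add_of_nonneg_right (by positivity)), fun n hn ↦ ?_⟩
  rw [Nat.card_divisors hn]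
  exact mod_cast prod_factorization_add_one_le hε hn

lemma norm_sum_Ioc_mul_le (w c : ℕ → ℂ) {a b : ℕ} {B : ℝ} (hab : a < b)
    (hB : ∀ k ∈ Icc a b, ‖∑ n ∈ Ioc a k, c n‖ ≤ B) :
    ‖∑ n ∈ Ioc a b, w n * c n‖ ≤
      (‖w (a + 1)‖ + ‖w b‖ + ∑ n ∈ Ico (a + 1) b, ‖w (n + 1) - w n‖) * B := by
  obtain ⟨m, rfl⟩ := Nat.exists_eq_add_one_of_ne_zero (by lia : b ≠ 0)
  have h := norm_sum_Ico_mul_sub_succ_le (fun n ↦ w (n + 1)) (fun k ↦ ∑ n ∈ Ioc a k, c n)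
    (by lia : a ≤ m) (fun k hk ↦ hB k hk)
  have hstep : ∑ n ∈ Ioc a (m + 1), w n * c n =
      -∑ n ∈ Ico a (m + 1), w (n + 1) * (∑ i ∈ Ioc a n, c i - ∑ i ∈ Ioc a (n + 1), c i) := by
    rw [← Ico_add_one_add_one_eq_Ioc, ← sum_Ico_add' (fun n ↦ w n * c n), ← sum_neg_distrib]
    refine sum_congr rfl fun n hn ↦ ?_
    rw [sum_Ioc_succ_top (by grind)]
    ring
  rwa [hstep, norm_neg, ← sum_Ico_add' (fun n ↦ ‖w (n + 1) - w n‖)]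

lemma norm_sum_Ioc_mul_le_of_monotoneOn_or_antitoneOn {w : ℕ → ℝ} {c : ℕ → ℂ} {a b : ℕ}
    {B W : ℝ} (hmono : MonotoneOn w (Set.Ioc a b) ∨ AntitoneOn w (Set.Ioc a b))
    (hw : ∀ n ∈ Ioc a b, w n ∈ Set.Icc 0 W) (hW : 0 ≤ W)
    (hB : ∀ k ∈ Icc a b, ‖∑ n ∈ Ioc a k, c n‖ ≤ B) (hB0 : 0 ≤ B) :
    ‖∑ n ∈ Ioc a b, (w n : ℂ) * c n‖ ≤ 2 * W * B := by
  rcases le_or_gt b a with hba | hab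
  · rw [Ioc_eq_empty_of_le hba, sum_empty, norm_zero]
    positivity
  refine (norm_sum_Ioc_mul_le _ c hab hB).trans (mul_le_mul_of_nonneg_right ?_ hB0)
  simp only [← Complex.ofReal_sub, Complex.norm_real, Real.norm_eq_abs]
  obtain ⟨ha0, haW⟩ := hw (a + 1) (by grind)
  obtain ⟨hb0, hbW⟩ := hw b (by grind)
  have hvar : ∑ n ∈ Ico (a + 1) b, |w (n + 1) - w n| = |w b - w (a + 1)| := by
    rw [← sum_Ico_sub w hab]
    rcases hmono with h | h
    · have hn {n : ℕ} (hn : n ∈ Ico (a + 1) b) : 0 ≤ w (n + 1) - w n :=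
        sub_nonneg.mpr (h (by grind) (by grind) n.le_succ)
      rw [abs_of_nonneg (sum_nonneg fun n ↦ hn), sum_congr rfl fun n h ↦ abs_of_nonneg (hn h)]
    · have hn {n : ℕ} (hn : n ∈ Ico (a + 1) b) : w (n + 1) - w n ≤ 0 :=
        sub_nonpos.mpr (h (by grind) (by grind) n.le_succ)
      rw [abs_of_nonpos (sum_nonpos fun n ↦ hn), sum_congr rfl fun n h ↦ abs_of_nonpos (hn h),
        sum_neg_distrib]
  rw [hvar, abs_of_nonneg ha0, abs_of_nonneg hb0]
  cases abs_cases (w b - w (a + 1)) <;> linarith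

/-- The truncation of an arithmetic function to arguments at most `U`, as used in Vaughan's
identity. -/
noncomputable def trunc (f : ArithmeticFunction ℝ) (U : ℕ) : ArithmeticFunction ℝ :=
  ⟨fun n ↦ if n ≤ U then f n else 0, by simp⟩

lemma trunc_apply (f : ArithmeticFunction ℝ) (U n : ℕ) :
    trunc f U n = if n ≤ U then f n else 0 := rfl

lemma sub_trunc_apply (f : ArithmeticFunction ℝ) (U n : ℕ) :
    (f - trunc f U) n = if n ≤ U then 0 else f n := by
  rw [sub_eq_add_neg, ArithmeticFunction.add_apply, ArithmeticFunction.neg_apply, trunc_apply]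
  split_ifs <;> simp

theorem vaughan (U V : ℕ) : (Λ : ArithmeticFunction ℝ) =
    trunc Λ V + trunc (μ : ArithmeticFunction ℝ) U * log
    - (trunc (μ : ArithmeticFunction ℝ) U * trunc Λ V) * (ζ : ArithmeticFunction ℝ)
    + (((μ : ArithmeticFunction ℝ) - trunc (μ : ArithmeticFunction ℝ) U) *
      (ζ : ArithmeticFunction ℝ)) * (Λ - trunc Λ V) := by
  have hμζ : (μ : ArithmeticFunction ℝ) * (ζ : ArithmeticFunction ℝ) = 1 :=
    coe_moebius_mul_coe_zeta
  have hΛζ : (Λ : ArithmeticFunction ℝ) * (ζ : ArithmeticFunction ℝ) = log := vonMangoldt_mul_zeta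
  linear_combination (trunc (μ : ArithmeticFunction ℝ) U) * hΛζ - (Λ - trunc Λ V) * hμζ

lemma sum_mul_apply (a b : ArithmeticFunction ℝ) (g : ℕ → ℂ) (X Y : ℕ) :
    ∑ n ∈ Ioc X Y, (((a * b) n : ℝ) : ℂ) * g n =
      ∑ k ∈ Ioc 0 Y, ∑ m ∈ Ioc (X / k) (Y / k), (a k : ℂ) * (b m : ℂ) * g (k * m) := by
  simp only [ArithmeticFunction.mul_apply, Complex.ofReal_sum, Complex.ofReal_mul, sum_mul]
  rw [sum_sigma', sum_sigma']
  refine sum_bij' (fun x _ ↦ ⟨x.2.1, x.2.2⟩) (fun x _ ↦ ⟨x.1 * x.2, (x.1, x.2)⟩) ?_ ?_ ?_ ?_ ?_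
  · rintro ⟨n, k, m⟩ h
    simp only [mem_sigma, mem_Ioc, Nat.mem_divisorsAntidiagonal] at h ⊢
    obtain ⟨⟨hXn, hnY⟩, rfl, hne⟩ := h
    obtain ⟨hk, hm⟩ : 0 < k ∧ 0 < m := by
      simpa only [Nat.pos_iff_ne_zero, ← mul_ne_zero_iff] using hne
    rw [Nat.div_lt_iff_lt_mul hk, Nat.le_div_iff_mul_le hk, mul_comm m]
    exact ⟨⟨hk, (Nat.le_mul_of_pos_right k hm).trans hnY⟩, hXn, hnY⟩
  · rintro ⟨k, m⟩ h
    simp only [mem_sigma, mem_Ioc, Nat.mem_divisorsAntidiagonal] at h ⊢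
    obtain ⟨⟨hk, -⟩, hm⟩ := h
    rw [Nat.div_lt_iff_lt_mul hk, Nat.le_div_iff_mul_le hk, mul_comm m] at hm
    exact ⟨hm, trivial, by lia⟩
  all_goals grind [Nat.mem_divisorsAntidiagonal]

end ArithmeticFunctions

section BilinearSums

open Finset
open scoped ComplexConjugate

lemma norm_sum_sq_le_card_mul {ι E : Type*} [SeminormedAddCommGroup E] (s : Finset ι)
    (f : ι → E) : ‖∑ i ∈ s, f i‖ ^ 2 ≤ #s * ∑ i ∈ s, ‖f i‖ ^ 2 :=
  (pow_le_pow_left₀ (norm_nonneg _) (norm_sum_le _ _) 2).trans sq_sum_le_card_mul_sum_sq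

lemma ofReal_sum_norm_sum_mul_sq {ι κ : Type*} (s : Finset ι) (t : Finset κ) (b : ι → ℂ)
    (G : ι → κ → ℂ) : ((∑ m ∈ t, ‖∑ n ∈ s, b n * G n m‖ ^ 2 : ℝ) : ℂ) =
      ∑ n₁ ∈ s, ∑ n₂ ∈ s, b n₁ * conj (b n₂) * ∑ m ∈ t, G n₁ m * conj (G n₂ m) := by
  have hsq (m : κ) : ((‖∑ n ∈ s, b n * G n m‖ ^ 2 : ℝ) : ℂ) =
      ∑ n₁ ∈ s, ∑ n₂ ∈ s, b n₁ * conj (b n₂) * (G n₁ m * conj (G n₂ m)) := by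
    rw [Complex.ofReal_pow, ← Complex.mul_conj', map_sum, sum_mul_sum]
    refine sum_congr rfl fun n₁ _ ↦ sum_congr rfl fun n₂ _ ↦ ?_
    rw [map_mul]
    ring
  simp only [Complex.ofReal_sum, hsq, mul_sum]
  rw [sum_comm]
  exact sum_congr rfl fun n₁ _ ↦ sum_comm

lemma sum_norm_sq_le_of_norm_correlation_le {ι κ : Type*} [LinearOrder ι] {s : Finset ι}
    {t : Finset κ} {b : ι → ℂ} {G : ι → κ → ℂ} {B R : ℝ} (hB : 0 ≤ B) (hR : 0 ≤ R)
    (hb : ∀ n ∈ s, ‖b n‖ ≤ B) (hG : ∀ n m, ‖G n m‖ ≤ 1)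
    (hcor : ∀ n₁ ∈ s, ∀ n₂ ∈ s, n₂ < n₁ → ‖∑ m ∈ t, G n₁ m * conj (G n₂ m)‖ ≤ R) :
    ∑ m ∈ t, ‖∑ n ∈ s, b n * G n m‖ ^ 2 ≤ B ^ 2 * (#s * (#t + #s * R)) := by
  have hD {n₁ n₂ : ι} (h₁ : n₁ ∈ s) (h₂ : n₂ ∈ s) :
      ‖∑ m ∈ t, G n₁ m * conj (G n₂ m)‖ ≤ (if n₁ = n₂ then (#t : ℝ) else 0) + R := by
    rcases lt_trichotomy n₁ n₂ with h | h | h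
    · rw [if_neg h.ne, zero_add, ← RCLike.norm_conj, map_sum]
      simpa only [map_mul, Complex.conj_conj, mul_comm] using hcor n₂ h₂ n₁ h₁ h
    · rw [if_pos h, ← nsmul_one #t]
      refine (norm_sum_le_of_le t fun m _ ↦ ?_).trans
        ((sum_const (1 : ℝ)).trans_le (le_add_of_nonneg_right hR))
      rw [norm_mul, RCLike.norm_conj]
      exact mul_le_one₀ (hG _ _) (norm_nonneg _) (hG _ _)
    · rw [if_neg h.ne', zero_add]
      exact hcor n₁ h₁ n₂ h₂ h
  calc ∑ m ∈ t, ‖∑ n ∈ s, b n * G n m‖ ^ 2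
      ≤ ‖((∑ m ∈ t, ‖∑ n ∈ s, b n * G n m‖ ^ 2 : ℝ) : ℂ)‖ := by
        rw [Complex.norm_real]
        exact le_abs_self _
    _ ≤ ∑ n₁ ∈ s, ∑ n₂ ∈ s, B * B * ((if n₁ = n₂ then (#t : ℝ) else 0) + R) := by
        rw [ofReal_sum_norm_sum_mul_sq]
        refine norm_sum_le_of_le s fun n₁ h₁ ↦ norm_sum_le_of_le s fun n₂ h₂ ↦ ?_
        rw [norm_mul, norm_mul, RCLike.norm_conj]
        gcongr
        exacts [hb n₁ h₁, hb n₂ h₂, hD h₁ h₂]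
    _ = ∑ n₁ ∈ s, B ^ 2 * (#t + #s * R) := by
        refine sum_congr rfl fun n₁ h₁ ↦ ?_
        rw [← mul_sum, sum_add_distrib, sum_ite_eq, if_pos h₁, sum_const, nsmul_eq_mul, sq]
    _ = _ := by
        rw [sum_const, nsmul_eq_mul]
        ring

lemma card_filter_div_eq_le (s : Finset ℕ) {Q : ℕ} (hQ : 0 < Q) (j : ℕ) :
    #{n ∈ s | n / Q = j} ≤ Q := by
  have hsub : {n ∈ s | n / Q = j} ⊆ Ico (j * Q) (j * Q + Q) := by
    intro n hn
    rw [mem_filter, Nat.div_eq_iff hQ] at hn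
    grind
  simpa only [Nat.card_Ico, add_tsub_cancel_left] using card_le_card hsub

lemma card_Icc_div_two_mul_div_le (K Q : ℕ) :
    (#(Icc (K / Q) (2 * K / Q)) : ℝ) ≤ (K : ℝ) / Q + 2 := by
  have hupper : ((2 * K / Q : ℕ) : ℝ) ≤ 2 * (K / Q) :=
    Nat.cast_div_le.trans_eq (by push_cast; ring)
  have hlower : (K : ℝ) / Q < (K / Q : ℕ) + 1 := by
    rw [← Nat.floor_div_eq_div (K := ℝ)]
    exact Nat.lt_floor_add_one _
  rw [Nat.card_Icc, Nat.cast_sub ((Nat.div_le_div_right (by lia)).trans (Nat.le_succ _))]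
  push_cast
  linarith

lemma sum_norm_sq_le_of_short_correlation {κ : Type*} {s : Finset ℕ} {t : Finset κ}
    {b : ℕ → ℂ} {G : ℕ → κ → ℂ} {K Q : ℕ} {B R : ℝ} (hs : s ⊆ Ico K (2 * K)) (hQ : 0 < Q)
    (hB : 0 ≤ B) (hR : 0 ≤ R) (hb : ∀ n ∈ s, ‖b n‖ ≤ B) (hG : ∀ n m, ‖G n m‖ ≤ 1)
    (hcor : ∀ n₁ ∈ s, ∀ n₂ ∈ s, n₂ < n₁ → n₁ < n₂ + Q →
      ‖∑ m ∈ t, G n₁ m * conj (G n₂ m)‖ ≤ R) :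
    ∑ m ∈ t, ‖∑ n ∈ s, b n * G n m‖ ^ 2 ≤ ((K : ℝ) / Q + 2) * (B ^ 2 * (K * (#t + Q * R))) := by
  set J := Icc (K / Q) (2 * K / Q)
  have hJ : ∀ n ∈ s, n / Q ∈ J := fun n hn ↦
    have := mem_Ico.mp (hs hn)
    mem_Icc.mpr ⟨Nat.div_le_div_right this.1, Nat.div_le_div_right this.2.le⟩
  have hblock (j : ℕ) : ∑ m ∈ t, ‖∑ n ∈ s with n / Q = j, b n * G n m‖ ^ 2 ≤
      B ^ 2 * (#{n ∈ s | n / Q = j} * (#t + Q * R)) := by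
    refine (sum_norm_sq_le_of_norm_correlation_le hB hR (fun n hn ↦ hb n (mem_filter.mp hn).1) hG
      fun n₁ h₁ n₂ h₂ hlt ↦ ?_).trans ?_
    · rw [mem_filter, Nat.div_eq_iff hQ] at h₁ h₂
      exact hcor n₁ h₁.1 n₂ h₂.1 hlt (by lia)
    · gcongr
      exact card_filter_div_eq_le _ hQ j
  have hcard : ∑ j ∈ J, #{n ∈ s | n / Q = j} ≤ K := by
    rw [← card_eq_sum_card_fiberwise hJ]
    exact (card_le_card hs).trans_eq (by rw [Nat.card_Ico]; lia)
  calc ∑ m ∈ t, ‖∑ n ∈ s, b n * G n m‖ ^ 2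
      ≤ ∑ m ∈ t, ((K : ℝ) / Q + 2) * ∑ j ∈ J, ‖∑ n ∈ s with n / Q = j, b n * G n m‖ ^ 2 := by
        refine sum_le_sum fun m _ ↦ ?_
        rw [← sum_fiberwise_of_maps_to hJ]
        refine (norm_sum_sq_le_card_mul _ _).trans ?_
        gcongr
        exact card_Icc_div_two_mul_div_le K Q
    _ = ((K : ℝ) / Q + 2) * ∑ j ∈ J, ∑ m ∈ t, ‖∑ n ∈ s with n / Q = j, b n * G n m‖ ^ 2 := by
        rw [← mul_sum, sum_comm]
    _ ≤ ((K : ℝ) / Q + 2) * ∑ j ∈ J, B ^ 2 * (#{n ∈ s | n / Q = j} * (#t + Q * R)) := by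
        gcongr with j
        exact hblock j
    _ = ((K : ℝ) / Q + 2) * (B ^ 2 * ((∑ j ∈ J, #{n ∈ s | n / Q = j} : ℕ) * (#t + Q * R))) := by
        rw [← mul_sum, ← sum_mul, Nat.cast_sum]
    _ ≤ _ := by gcongr

lemma sum_ite_mem_mul_conj_ite_mem {κ : Type*} [DecidableEq κ] {t u v : Finset κ} (hu : u ⊆ t)
    (f h : κ → ℂ) :
    ∑ m ∈ t, (if m ∈ u then f m else 0) * conj (if m ∈ v then h m else 0) =
      ∑ m ∈ u ∩ v, f m * conj (h m) := by
  simp only [apply_ite conj, map_zero, ite_mul, zero_mul, mul_ite, mul_zero]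
  rw [sum_ite_mem, sum_ite_mem, inter_assoc, inter_comm v, ← inter_assoc, inter_eq_right.mpr hu]

lemma sum_sum_Ioc_div_mul_eq (a b g : ℕ → ℂ) (X Y : ℕ) {K : ℕ} {s : Finset ℕ} (hK : 0 < K)
    (hs : ∀ n ∈ s, K ≤ n) :
    ∑ n ∈ s, ∑ m ∈ Ioc (X / n) (Y / n), b n * a m * g (n * m) =
      ∑ m ∈ Ioc 0 (Y / K), a m *
        ∑ n ∈ s, b n * if m ∈ Ioc (X / n) (Y / n) then g (n * m) else 0 := by
  simp only [mul_sum]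
  rw [sum_comm (s := Ioc 0 (Y / K))]
  refine sum_congr rfl fun n hn ↦ ?_
  simp only [mul_ite, mul_zero]
  rw [sum_ite_mem, inter_eq_right.mpr
    (Ioc_subset_Ioc (Nat.zero_le _) (Nat.div_le_div_left (hs n hn) hK))]
  exact sum_congr rfl fun m _ ↦ by ring

theorem norm_bilinear_dyadic_sq_le {a b g : ℕ → ℂ} {X Y K Q : ℕ} {A B R : ℝ} {s : Finset ℕ}
    (hK : 0 < K) (hQ : 0 < Q) (hY : Y ≤ 3 * X) (hs : s ⊆ Ico K (2 * K)) (hg : ∀ n, ‖g n‖ ≤ 1)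
    (hB : 0 ≤ B) (hR : 0 ≤ R) (ha : ∀ m ≤ Y, ‖a m‖ ≤ A) (hb : ∀ n ∈ s, ‖b n‖ ≤ B)
    (hcor : ∀ n₁ ∈ s, ∀ n₂ ∈ s, n₂ < n₁ → n₁ < n₂ + Q →
      ‖∑ m ∈ Ioc (max (X / n₁) (X / n₂)) (min (Y / n₁) (Y / n₂)),
        g (n₁ * m) * conj (g (n₂ * m))‖ ≤ R) :
    ‖∑ n ∈ s, ∑ m ∈ Ioc (X / n) (Y / n), b n * a m * g (n * m)‖ ^ 2 ≤
      A ^ 2 * B ^ 2 * (3 * X / K) * ((K : ℝ) / Q + 2) * (K * (3 * X / K + Q * R)) := by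
  have hM : ((Y / K : ℕ) : ℝ) ≤ 3 * X / K :=
    Nat.cast_div_le.trans (by gcongr; exact mod_cast hY)
  have hK_le {n : ℕ} (hn : n ∈ s) : K ≤ n := (mem_Ico.mp (hs hn)).1
  set G : ℕ → ℕ → ℂ := fun n m ↦ if m ∈ Ioc (X / n) (Y / n) then g (n * m) else 0
  have hG (n m : ℕ) : ‖G n m‖ ≤ 1 := by
    simp only [G]
    split_ifs
    exacts [hg _, norm_zero.trans_le zero_le_one]
  have hsieve : ∑ m ∈ Ioc 0 (Y / K), ‖∑ n ∈ s, b n * G n m‖ ^ 2 ≤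
      ((K : ℝ) / Q + 2) * (B ^ 2 * (K * ((Y / K : ℕ) + Q * R))) := by
    simpa only [Nat.card_Ioc, Nat.sub_zero] using
      sum_norm_sq_le_of_short_correlation (t := Ioc 0 (Y / K)) hs hQ hB hR hb hG
        fun n₁ h₁ n₂ h₂ hlt hQ' ↦ by
          rw [sum_ite_mem_mul_conj_ite_mem
            (Ioc_subset_Ioc (Nat.zero_le _) (Nat.div_le_div_left (hK_le h₁) hK)), Ioc_inter_Ioc]
          exact hcor n₁ h₁ n₂ h₂ hlt hQ'
  rw [sum_sum_Ioc_div_mul_eq a b g X Y hK fun n ↦ hK_le]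
  calc ‖∑ m ∈ Ioc 0 (Y / K), a m * ∑ n ∈ s, b n * G n m‖ ^ 2
      ≤ (Y / K : ℕ) * ∑ m ∈ Ioc 0 (Y / K), ‖a m * ∑ n ∈ s, b n * G n m‖ ^ 2 := by
        simpa only [Nat.card_Ioc, Nat.sub_zero] using norm_sum_sq_le_card_mul (Ioc 0 (Y / K)) _
    _ ≤ (Y / K : ℕ) * ∑ m ∈ Ioc 0 (Y / K), A ^ 2 * ‖∑ n ∈ s, b n * G n m‖ ^ 2 := by
        gcongr with m hm
        rw [norm_mul, mul_pow]
        gcongr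
        exact ha m ((mem_Ioc.mp hm).2.trans (Nat.div_le_self _ _))
    _ ≤ (3 * X / K) * (A ^ 2 * (((K : ℝ) / Q + 2) * (B ^ 2 * (K * (3 * X / K + Q * R))))) := by
        rw [← mul_sum]
        gcongr
        exact hsieve.trans (by gcongr)
    _ = _ := by ring

lemma dyadic_bound_le {X K Q F Z A₀ : ℝ} (hX : 0 ≤ X) (hK : 0 < K) (hQ : 0 < Q) (hF : 0 < F)
    (hA₀ : 1 ≤ A₀) (hQK : Q ≤ 2 * K) (hKZ : K ≤ Z) :
    (3 * X / K) * (K / Q + 2) *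
        (K * (3 * X / K + Q * (A₀ * (√(F * Q / K) + X / K * √(K / F))))) ≤
      49 * A₀ ^ 2 * (X ^ 2 / Q + X * √(F * Q * Z) + X ^ 2 * √(Z / F)) := by
  have hKQ : K / Q + 2 ≤ 5 * (K / Q) := by
    have : 1 ≤ 2 * K / Q := (one_le_div hQ).mpr hQK
    linarith [mul_div_assoc 2 K Q]
  have hsqrt : K * √(F * Q / K) ≤ √(F * Q * Z) := by
    refine Real.le_sqrt_of_sq_le ?_
    rw [mul_pow, Real.sq_sqrt (by positivity)]
    calc K ^ 2 * (F * Q / K) = F * Q * K := by field_simp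
      _ ≤ F * Q * Z := by gcongr
  calc _ = 3 * X * (K / Q + 2) / K * (3 * X +
        Q * (A₀ * (K * √(F * Q / K) + X * √(K / F)))) := by field_simp
    _ ≤ 3 * X * (5 * (K / Q)) / K * (3 * (A₀ * X) +
        Q * (3 * A₀ * (√(F * Q * Z) + X * √(Z / F)))) := by
        gcongr
        · exact le_mul_of_one_le_left hX hA₀
        · linarith
    _ = 45 * A₀ * (X ^ 2 / Q + X * √(F * Q * Z) + X ^ 2 * √(Z / F)) := by
        field_simp
        ring
    _ ≤ _ := by
        gcongr
        · norm_num
        · exact le_self_pow₀ hA₀ two_ne_zero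

/-- The type II information on `g` used for bilinear sums over `X < n * m ≤ Y`: the correlations
of `m ↦ g (n₁ * m)` and `m ↦ g (n₂ * m)`, with `n₁` and `n₂` in a common dyadic block, are as small
as the second derivative test predicts when `g` is an exponential whose phase has size `F`. -/
def TypeIIBound (g : ℕ → ℂ) (X Y : ℕ) (A F : ℝ) : Prop :=
  ∀ K : ℕ, ∀ n₁ ∈ Ico K (2 * K), ∀ n₂ ∈ Ico K (2 * K), n₂ < n₁ →
    ‖∑ m ∈ Ioc (max (X / n₁) (X / n₂)) (min (Y / n₁) (Y / n₂)),
      g (n₁ * m) * conj (g (n₂ * m))‖ ≤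
      A * (√(F * (n₁ - n₂) / K) + X / K * (√(F * (n₁ - n₂) / K))⁻¹)

lemma norm_bilinear_dyadic_le {a b g : ℕ → ℂ} {X Y K Q : ℕ} {A B A₀ F Z : ℝ} {s : Finset ℕ}
    (hK : 0 < K) (hQ : 0 < Q) (hY : Y ≤ 3 * X) (hs : s ⊆ Ico K (2 * K)) (hg : ∀ n, ‖g n‖ ≤ 1)
    (hA : 0 ≤ A) (hB : 0 ≤ B) (hA₀ : 1 ≤ A₀) (hF : 0 < F) (hQK : Q ≤ 2 * K) (hKZ : (K : ℝ) ≤ Z)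
    (ha : ∀ m ≤ Y, ‖a m‖ ≤ A) (hb : ∀ n ∈ s, ‖b n‖ ≤ B)
    (hcor : TypeIIBound g X Y A₀ F) :
    ‖∑ n ∈ s, ∑ m ∈ Ioc (X / n) (Y / n), b n * a m * g (n * m)‖ ≤
      7 * A₀ * A * B * √(X ^ 2 / Q + X * √(F * Q * Z) + X ^ 2 * √(Z / F)) := by
  have hK' : (0 : ℝ) < K := mod_cast hK
  have hQ' : (0 : ℝ) < Q := mod_cast hQ
  have hshort {n₁ n₂ : ℕ} (hlt : n₂ < n₁) (hle : n₁ < n₂ + Q) :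
      √(F * (n₁ - n₂) / K) + X / K * (√(F * (n₁ - n₂) / K))⁻¹ ≤
        √(F * Q / K) + X / K * √(K / F) := by
    have hlt' : (n₂ : ℝ) + 1 ≤ n₁ := mod_cast hlt
    have hle' : (n₁ : ℝ) < n₂ + Q := mod_cast hle
    rw [← Real.sqrt_inv, inv_div]
    gcongr
    · linarith
    · exact le_mul_of_one_le_right hF.le (by linarith)
  refine le_of_sq_le_sq ((norm_bilinear_dyadic_sq_le (R := A₀ * (√(F * Q / K) + X / K * √(K / F)))
    hK hQ hY hs hg hB (by positivity) ha hb fun n₁ h₁ n₂ h₂ hlt hle ↦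
      (hcor K n₁ (hs h₁) n₂ (hs h₂) hlt).trans (by gcongr _ * ?_; exact hshort hlt hle)).trans ?_)
    (by positivity)
  calc _ = A ^ 2 * B ^ 2 * ((3 * X / K) * (K / Q + 2) *
        (K * (3 * X / K + Q * (A₀ * (√(F * Q / K) + X / K * √(K / F)))))) := by ring
    _ ≤ A ^ 2 * B ^ 2 *
        (49 * A₀ ^ 2 * (X ^ 2 / Q + X * √(F * Q * Z) + X ^ 2 * √(Z / F))) := by
        gcongr _ * ?_
        exact dyadic_bound_le (Nat.cast_nonneg X) hK' hQ' hF hA₀ (mod_cast hQK) hKZ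
    _ = _ := by
        rw [mul_pow, Real.sq_sqrt (by have := hKZ.trans' hK'.le; positivity)]
        ring

theorem norm_bilinear_le {a b g : ℕ → ℂ} {X Y Q : ℕ} {A B A₀ F Z : ℝ} (hQ : 0 < Q)
    (hY : Y ≤ 3 * X) (hg : ∀ n, ‖g n‖ ≤ 1) (hA : 0 ≤ A) (hB : 0 ≤ B) (hA₀ : 1 ≤ A₀) (hF : 0 < F)
    (ha : ∀ m ≤ Y, ‖a m‖ ≤ A) (hb : ∀ n ≤ Y, ‖b n‖ ≤ B) (hbQ : ∀ n ≤ Q, b n = 0)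
    (hZ : ∀ n m, n * m ≤ Y → b n ≠ 0 → a m ≠ 0 → (n : ℝ) ≤ Z)
    (hcor : TypeIIBound g X Y A₀ F) :
    ‖∑ n ∈ Ioc 0 Y, ∑ m ∈ Ioc (X / n) (Y / n), b n * a m * g (n * m)‖ ≤
      (Nat.log 2 Y + 1) *
        (7 * A₀ * A * B * √(X ^ 2 / Q + X * √(F * Q * Z) + X ^ 2 * √(Z / F))) := by
  set t : ℕ → ℂ := fun n ↦ ∑ m ∈ Ioc (X / n) (Y / n), b n * a m * g (n * m)
  have hlog : ∀ n ∈ Ioc 0 Y, Nat.log 2 n ∈ range (Nat.log 2 Y + 1) := fun n hn ↦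
    mem_range_succ_iff.mpr (Nat.log_mono_right (mem_Ioc.mp hn).2)
  rw [← sum_fiberwise_of_maps_to hlog]
  refine (norm_sum_le_of_le (range (Nat.log 2 Y + 1)) fun i _ ↦ ?_).trans_eq
    (by rw [sum_const, card_range, nsmul_eq_mul, Nat.cast_succ])
  have hs : {n ∈ Ioc 0 Y | Nat.log 2 n = i} ⊆ Ico (2 ^ i) (2 * 2 ^ i) := by
    intro n hn
    obtain ⟨hnY, rfl⟩ := mem_filter.mp hn
    have hn0 : n ≠ 0 := by grind
    exact mem_Ico.mpr ⟨Nat.pow_log_le_self 2 hn0, pow_succ' 2 (Nat.log 2 n) ▸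
      Nat.lt_pow_succ_log_self one_lt_two n⟩
  by_cases hzero : ∀ n ∈ {n ∈ Ioc 0 Y | Nat.log 2 n = i}, t n = 0
  · rw [sum_eq_zero hzero, norm_zero]
    positivity
  push Not at hzero
  obtain ⟨n, hn, htn⟩ := hzero
  obtain ⟨m, hm, hbag⟩ := exists_ne_zero_of_sum_ne_zero htn
  obtain ⟨⟨hbn, ham⟩, -⟩ : (b n ≠ 0 ∧ a m ≠ 0) ∧ g (n * m) ≠ 0 := by
    simpa only [mul_ne_zero_iff] using hbag
  have hQn : Q < n := not_le.mp (mt (hbQ n) hbn)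
  have hnm : n * m ≤ Y := by
    rw [mem_Ioc, Nat.le_div_iff_mul_le (by lia), mul_comm] at hm
    exact hm.2
  have hnK := mem_Ico.mp (hs hn)
  exact norm_bilinear_dyadic_le (by positivity) hQ hY hs hg hA hB hA₀ hF (by lia)
    ((Nat.cast_le.mpr hnK.1).trans (hZ n m hnm hbn ham)) ha (fun n hn ↦ hb n (by grind)) hcor

end BilinearSums

section Vaughan

open Finset ArithmeticFunction
open scoped ArithmeticFunction.zeta ArithmeticFunction.Moebius

lemma abs_trunc_le (f : ArithmeticFunction ℝ) (U n : ℕ) : |trunc f U n| ≤ |f n| := by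
  rw [trunc_apply]
  split_ifs <;> simp

lemma abs_sub_trunc_le (f : ArithmeticFunction ℝ) (U n : ℕ) : |(f - trunc f U) n| ≤ |f n| := by
  rw [sub_trunc_apply]
  split_ifs <;> simp

lemma abs_intCoe_moebius_le_one (n : ℕ) : |(μ : ArithmeticFunction ℝ) n| ≤ 1 := by
  rw [intCoe_apply, ← Int.cast_abs]
  exact_mod_cast abs_moebius_le_one

/-- The coefficients of the second type I sum in Vaughan's identity. -/
noncomputable def typeICoeff (U V : ℕ) : ArithmeticFunction ℝ :=
  trunc (μ : ArithmeticFunction ℝ) U * trunc Λ V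

/-- The coefficients which accompany the large values of `Λ` in Vaughan's identity. -/
noncomputable def typeIICoeff (U : ℕ) : ArithmeticFunction ℝ :=
  ((μ : ArithmeticFunction ℝ) - trunc (μ : ArithmeticFunction ℝ) U) * (ζ : ArithmeticFunction ℝ)

lemma abs_typeICoeff_le (U V n : ℕ) : |typeICoeff U V n| ≤ Real.log n := by
  rw [typeICoeff, ArithmeticFunction.mul_apply, ← vonMangoldt_sum,
    ← Nat.sum_divisorsAntidiagonal' (fun _ i ↦ Λ i)]
  refine (abs_sum_le_sum_abs _ _).trans (sum_le_sum fun p _ ↦ ?_)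
  rw [abs_mul]
  exact (mul_le_of_le_one_left (abs_nonneg _)
    ((abs_trunc_le _ _ _).trans (abs_intCoe_moebius_le_one _))).trans
      ((abs_trunc_le _ _ _).trans_eq (abs_of_nonneg vonMangoldt_nonneg))

lemma typeICoeff_eq_zero {U V n : ℕ} (hn : U * V < n) : typeICoeff U V n = 0 := by
  rw [typeICoeff, ArithmeticFunction.mul_apply]
  refine sum_eq_zero fun p hp ↦ ?_
  rw [trunc_apply, trunc_apply]
  by_cases hU : p.1 ≤ U
  · have hV : ¬ p.2 ≤ V := fun hV ↦
      ((Nat.mul_le_mul hU hV).trans_lt hn).ne (Nat.mem_divisorsAntidiagonal.mp hp).1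
    rw [if_neg hV, mul_zero]
  · rw [if_neg hU, zero_mul]

lemma abs_typeIICoeff_le (U n : ℕ) : |typeIICoeff U n| ≤ #n.divisors := by
  rw [typeIICoeff, coe_mul_zeta_apply, ← nsmul_one, ← sum_const]
  exact (abs_sum_le_sum_abs _ _).trans (sum_le_sum fun i _ ↦
    (abs_sub_trunc_le _ _ _).trans (abs_intCoe_moebius_le_one i))

lemma typeIICoeff_eq_zero {U n : ℕ} (hn : n ≤ U) : typeIICoeff U n = 0 := by
  rw [typeIICoeff, coe_mul_zeta_apply]
  exact sum_eq_zero fun i hi ↦ by rw [sub_trunc_apply, if_pos ((Nat.divisor_le hi).trans hn)]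

lemma sum_vonMangoldt_mul_eq (g : ℕ → ℂ) {X Q : ℕ} (hQ : Q ≤ X) (Y : ℕ) :
    ∑ n ∈ Ioc X Y, (Λ n : ℂ) * g n =
      ∑ n ∈ Ioc X Y, (((trunc (μ : ArithmeticFunction ℝ) Q * log) n : ℝ) : ℂ) * g n
      - ∑ n ∈ Ioc X Y, (((typeICoeff Q Q * (ζ : ArithmeticFunction ℝ)) n : ℝ) : ℂ) * g n
      + ∑ n ∈ Ioc X Y, (((typeIICoeff Q * (Λ - trunc Λ Q)) n : ℝ) : ℂ) * g n := by
  rw [← sum_sub_distrib, ← sum_add_distrib]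
  refine sum_congr rfl fun n hn ↦ ?_
  have hΛ : trunc Λ Q n = 0 := by rw [trunc_apply, if_neg (by grind)]
  have hvaughan := congrArg (fun f : ArithmeticFunction ℝ ↦ f n) (vaughan Q Q)
  simp only [sub_eq_add_neg, ArithmeticFunction.add_apply, ArithmeticFunction.neg_apply, hΛ,
    zero_add] at hvaughan
  rw [hvaughan, typeICoeff, typeIICoeff]
  push_cast [sub_eq_add_neg]
  ring

lemma log_natCast_le_natLog_add_one {m n : ℕ} (h : m ≤ n) : Real.log m ≤ Nat.log 2 n + 1 := by
  rcases m.eq_zero_or_pos with rfl | hm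
  · rw [Nat.cast_zero, Real.log_zero]
    positivity
  calc Real.log m ≤ Real.log ((2 : ℝ) ^ (Nat.log 2 n + 1)) := by
        gcongr
        exact mod_cast h.trans (Nat.lt_pow_succ_log_self one_lt_two n).le
    _ = (Nat.log 2 n + 1) * Real.log 2 := by rw [Real.log_pow, Nat.cast_succ]
    _ ≤ Nat.log 2 n + 1 :=
        mul_le_of_le_one_right (by positivity) (Real.log_two_lt_d9.le.trans (by norm_num))

/-- The type I information on `g` used for sums over `X < m * n ≤ Y`: a bound for sums of `g` over
multiples of `m` in short intervals which start at `X`. -/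
def TypeIBound (g : ℕ → ℂ) (X Y : ℕ) (T : ℝ) : Prop :=
  ∀ m ∈ Ioc 0 Y, ∀ b ∈ Icc (X / m) (Y / m), ‖∑ n ∈ Ioc (X / m) b, g (m * n)‖ ≤ T

lemma norm_sum_mul_apply_le {c w : ArithmeticFunction ℝ} {g : ℕ → ℂ} {X Y M : ℕ} {C T : ℝ}
    (hC : 0 ≤ C) (hT : 0 ≤ T) (hc : ∀ k ≤ Y, |c k| ≤ C) (hcM : ∀ k, M < k → c k = 0)
    (hg : ∀ k ∈ Ioc 0 Y, ‖∑ m ∈ Ioc (X / k) (Y / k), (w m : ℂ) * g (k * m)‖ ≤ T) :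
    ‖∑ n ∈ Ioc X Y, (((c * w) n : ℝ) : ℂ) * g n‖ ≤ M * (C * T) := by
  have hterm {k : ℕ} (hk : k ∈ Ioc 0 Y) :
      ‖∑ m ∈ Ioc (X / k) (Y / k), (c k : ℂ) * (w m : ℂ) * g (k * m)‖ ≤
        if k ∈ Ioc 0 M then C * T else 0 := by
    simp only [mul_assoc, ← mul_sum]
    rw [norm_mul, Complex.norm_real, Real.norm_eq_abs]
    split_ifs with h
    · exact mul_le_mul (hc k (mem_Ioc.mp hk).2) (hg k hk) (norm_nonneg _) hC
    · rw [hcM k (by grind), abs_zero, zero_mul]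
  rw [sum_mul_apply]
  refine (norm_sum_le_of_le _ fun k ↦ hterm).trans ?_
  rw [sum_ite_mem, sum_const, nsmul_eq_mul]
  gcongr
  exact (card_le_card inter_subset_right).trans_eq (Nat.card_Ioc 0 M)

lemma norm_sum_trunc_moebius_mul_log_le {g : ℕ → ℂ} {X Y : ℕ} {D T : ℝ} (Q : ℕ)
    (hD : Nat.log 2 Y + 1 ≤ D) (hT : 0 ≤ T) (hg : TypeIBound g X Y T) :
    ‖∑ n ∈ Ioc X Y, (((trunc (μ : ArithmeticFunction ℝ) Q * log) n : ℝ) : ℂ) * g n‖ ≤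
      Q * (1 * (2 * D * T)) := by
  have hD0 : 0 ≤ D := hD.trans' (by positivity)
  refine norm_sum_mul_apply_le zero_le_one (by positivity)
    (fun k _ ↦ (abs_trunc_le _ _ _).trans (abs_intCoe_moebius_le_one k))
    (fun k hk ↦ by rw [trunc_apply, if_neg hk.not_ge])
    (fun k hk ↦ norm_sum_Ioc_mul_le_of_monotoneOn_or_antitoneOn (.inl fun m hm n _ hmn ↦ ?_)
      (fun n hn ↦ ⟨Real.log_natCast_nonneg n, ?_⟩) hD0 (hg k hk) hT)
  · exact Real.log_le_log (mod_cast hm.1.pos) (mod_cast hmn)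
  · exact (log_natCast_le_natLog_add_one
      ((mem_Ioc.mp hn).2.trans (Nat.div_le_self Y k))).trans hD

lemma norm_sum_typeICoeff_mul_zeta_le {g : ℕ → ℂ} {X Y : ℕ} {D T : ℝ} (Q : ℕ)
    (hD : Nat.log 2 Y + 1 ≤ D) (hT : 0 ≤ T) (hg : TypeIBound g X Y T) :
    ‖∑ n ∈ Ioc X Y, (((typeICoeff Q Q * (ζ : ArithmeticFunction ℝ)) n : ℝ) : ℂ) * g n‖ ≤
      (Q * Q : ℕ) * (D * T) := by
  refine norm_sum_mul_apply_le (hD.trans' (by positivity)) hT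
    (fun k hk ↦ (abs_typeICoeff_le Q Q k).trans ((log_natCast_le_natLog_add_one hk).trans hD))
    (fun k hk ↦ typeICoeff_eq_zero hk) fun k hk ↦ ?_
  rcases le_total (X / k) (Y / k) with h | h
  · convert hg k hk (Y / k) (right_mem_Icc.mpr h) using 3 with m hm
    rw [natCoe_apply, zeta_apply_ne (by grind), Nat.cast_one, Complex.ofReal_one, one_mul]
  · simpa only [Ioc_eq_empty_of_le h, sum_empty, norm_zero] using hT

lemma natCast_le_three_mul_sqrt_of_mul_le {X n m : ℕ} (hm : √X < m) (hnm : n * m ≤ 3 * X) :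
    (n : ℝ) ≤ 3 * √X := by
  rcases X.eq_zero_or_pos with rfl | hX
  · have hm0 : 0 < m := by simpa using hm
    have hn : n = 0 := by nlinarith
    simp [hn]
  refine le_of_mul_le_mul_right ?_ (Real.sqrt_pos.mpr (Nat.cast_pos.mpr hX))
  calc (n : ℝ) * √X ≤ n * m := by gcongr
    _ ≤ 3 * X := mod_cast hnm
    _ = 3 * √X * √X := by rw [mul_assoc, Real.mul_self_sqrt (Nat.cast_nonneg X)]

lemma norm_sum_mul_apply_le_of_typeIIBound {f h : ArithmeticFunction ℝ} {g : ℕ → ℂ} {X Y Q : ℕ}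
    {A₀ F D : ℝ} (hQ : 0 < Q) (hY : Y ≤ 3 * X) (hg : ∀ n, ‖g n‖ ≤ 1) (hA₀ : 1 ≤ A₀)
    (hF : 0 < F) (hD : 0 ≤ D) (hf : ∀ n ≤ Y, |f n| ≤ D) (hh : ∀ n ≤ Y, |h n| ≤ D)
    (hfQ : ∀ n ≤ Q, f n = 0) (hhQ : ∀ n ≤ Q, h n = 0) (hII : TypeIIBound g X Y A₀ F) :
    ‖∑ n ∈ Ioc X Y, (((f * h) n : ℝ) : ℂ) * g n‖ ≤ 2 * ((Nat.log 2 Y + 1) * (7 * A₀ * D * D *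
      √(X ^ 2 / Q + X * √(F * Q * (3 * √X)) + X ^ 2 * √(3 * √X / F)))) := by
  set S := Nat.sqrt X
  have hS_le : (S : ℝ) ≤ √X := Real.nat_sqrt_le_real_sqrt
  have hlt_S : √X < S + 1 := Real.real_sqrt_lt_nat_sqrt_succ
  have hsplit : ∑ n ∈ Ioc X Y, (((f * h) n : ℝ) : ℂ) * g n =
      ∑ n ∈ Ioc X Y, (((trunc h S * f) n : ℝ) : ℂ) * g n +
        ∑ n ∈ Ioc X Y, (((f * (h - trunc h S)) n : ℝ) : ℂ) * g n := by
    rw [← sum_add_distrib]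
    refine sum_congr rfl fun n _ ↦ ?_
    rw [← add_mul, ← Complex.ofReal_add, ← ArithmeticFunction.add_apply]
    congr 4
    ring
  rw [hsplit, two_mul, sum_mul_apply, sum_mul_apply]
  refine (norm_add_le _ _).trans (add_le_add ?_ ?_) <;>
    refine norm_bilinear_le hQ hY hg hD hD hA₀ hF ?_ ?_ ?_ ?_ hII
  · exact fun m hm ↦ (Complex.norm_real _).trans_le (hf m hm)
  · exact fun n hn ↦ (Complex.norm_real _).trans_le ((abs_trunc_le _ _ _).trans (hh n hn))
  · exact fun n hn ↦ by rw [trunc_apply, hhQ n hn, ite_self, Complex.ofReal_zero]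
  · intro n m _ hn _
    have hnS : n ≤ S := by
      by_contra hnS
      exact hn (by rw [trunc_apply, if_neg hnS, Complex.ofReal_zero])
    linarith [(Nat.cast_le (α := ℝ)).mpr hnS, Real.sqrt_nonneg X]
  · exact fun m hm ↦ (Complex.norm_real _).trans_le ((abs_sub_trunc_le _ _ _).trans (hh m hm))
  · exact fun n hn ↦ (Complex.norm_real _).trans_le (hf n hn)
  · exact fun n hn ↦ by rw [hfQ n hn, Complex.ofReal_zero]
  · intro n m hnm _ hm
    have hSm : S + 1 ≤ m := by
      by_contra hSm
      exact hm (by rw [sub_trunc_apply, if_pos (by lia), Complex.ofReal_zero])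
    exact natCast_le_three_mul_sqrt_of_mul_le (hlt_S.trans_le (mod_cast hSm)) (hnm.trans hY)

lemma pow_rpow_eq_pow {y : ℝ} (hy : 0 ≤ y) {m n : ℕ} {r : ℝ} (h : m * r = n) :
    (y ^ m) ^ r = y ^ n := by
  rw [← Real.rpow_natCast_mul hy, h, Real.rpow_natCast]

lemma exists_eq_pow_and_eq_pow {x F : ℝ} (hx : 1 ≤ x) (hF : x ^ (11 / 12 : ℝ) ≤ F) :
    ∃ y f : ℝ, 1 ≤ y ∧ 0 < f ∧ y ^ 11 ≤ f ^ 2 ∧ x = y ^ 24 ∧ F = f ^ 4 := by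
  have hF0 : 0 < F := hF.trans_lt' (by positivity)
  refine ⟨x ^ ((24 : ℕ)⁻¹ : ℝ), F ^ ((4 : ℕ)⁻¹ : ℝ), Real.one_le_rpow hx (by positivity),
    by positivity, ?_, (Real.rpow_inv_natCast_pow (by positivity) (by norm_num)).symm,
    (Real.rpow_inv_natCast_pow hF0.le (by norm_num)).symm⟩
  calc (x ^ ((24 : ℕ)⁻¹ : ℝ)) ^ 11 = (x ^ (11 / 12 : ℝ)) ^ (1 / 2 : ℝ) := by
        rw [← Real.rpow_mul_natCast (by positivity), ← Real.rpow_mul (by positivity)]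
        norm_num
    _ ≤ F ^ (1 / 2 : ℝ) := by gcongr
    _ = (F ^ ((4 : ℕ)⁻¹ : ℝ)) ^ 2 := by
        rw [← Real.rpow_mul_natCast hF0.le]
        norm_num

lemma rpow_mul_sqrt_add_le {x F : ℝ} (hx : 1 ≤ x) (hF : x ^ (11 / 12 : ℝ) ≤ F) :
    x ^ (1 / 3 : ℝ) * (√F + x * (√F)⁻¹) ≤
      x ^ (11 / 12 : ℝ) + x ^ (1 / 3 : ℝ) * F ^ (1 / 2 : ℝ) := by
  obtain ⟨y, f, hy, hf, hyf, rfl, rfl⟩ := exists_eq_pow_and_eq_pow hx hF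
  have hy0 : 0 ≤ y := zero_le_one.trans hy
  rw [Real.sqrt_eq_rpow, pow_rpow_eq_pow hf.le (n := 2) (by norm_num),
    pow_rpow_eq_pow hy0 (n := 8) (by norm_num), pow_rpow_eq_pow hy0 (n := 22) (by norm_num),
    mul_add, add_comm]
  gcongr
  rw [← mul_assoc, ← div_eq_mul_inv, div_le_iff₀ (by positivity)]
  calc y ^ 8 * y ^ 24 = y ^ 21 * y ^ 11 := by ring
    _ ≤ y ^ 22 * f ^ 2 := by gcongr; norm_num

lemma sqrt_typeII_le {x F Q : ℝ} (hx : 1 ≤ x) (hF : x ^ (11 / 12 : ℝ) ≤ F) (hQ : 0 < Q)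
    (hQx : Q ≤ x ^ (1 / 6 : ℝ)) (hxQ : x ^ (1 / 6 : ℝ) ≤ 2 * Q) :
    √(x ^ 2 / Q + x * √(F * Q * (3 * √x)) + x ^ 2 * √(3 * √x / F)) ≤
      2 * (x ^ (11 / 12 : ℝ) + x ^ (2 / 3 : ℝ) * F ^ (1 / 4 : ℝ)) := by
  obtain ⟨y, f, hy, hf, hyf, rfl, rfl⟩ := exists_eq_pow_and_eq_pow hx hF
  have hy0 : 0 < y := zero_lt_one.trans_le hy
  have hsqrt : √(y ^ 24) = y ^ 12 := by
    rw [show y ^ 24 = (y ^ 12) ^ 2 by ring, Real.sqrt_sq (by positivity)]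
  rw [pow_rpow_eq_pow hy0.le (n := 4) (by norm_num)] at hQx hxQ
  rw [hsqrt, pow_rpow_eq_pow hf.le (n := 1) (by norm_num),
    pow_rpow_eq_pow hy0.le (n := 22) (by norm_num),
    pow_rpow_eq_pow hy0.le (n := 16) (by norm_num), pow_one]
  have h₁ : (y ^ 24) ^ 2 / Q ≤ 2 * y ^ 44 := by
    rw [div_le_iff₀ hQ]
    calc (y ^ 24) ^ 2 = y ^ 44 * y ^ 4 := by ring
      _ ≤ y ^ 44 * (2 * Q) := by gcongr
      _ = 2 * y ^ 44 * Q := by ring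
  have h₂ : √(f ^ 4 * Q * (3 * y ^ 12)) ≤ 2 * (y ^ 8 * f ^ 2) := by
    refine Real.sqrt_le_iff.mpr ⟨by positivity, ?_⟩
    calc f ^ 4 * Q * (3 * y ^ 12) ≤ f ^ 4 * y ^ 4 * (4 * y ^ 12) := by gcongr; norm_num
      _ = (2 * (y ^ 8 * f ^ 2)) ^ 2 := by ring
  have h₃ : √(3 * y ^ 12 / f ^ 4) ≤ 2 * (y ^ 4)⁻¹ := by
    refine Real.sqrt_le_iff.mpr ⟨by positivity, ?_⟩
    calc 3 * y ^ 12 / f ^ 4 ≤ 4 * y ^ 14 / (y ^ 11) ^ 2 := by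
          have : (y ^ 11) ^ 2 ≤ f ^ 4 := by
            simpa only [← pow_mul] using pow_le_pow_left₀ (by positivity) hyf 2
          gcongr <;> norm_num
      _ = (2 * (y ^ 4)⁻¹) ^ 2 := by field_simp; ring
  refine Real.sqrt_le_iff.mpr ⟨by positivity, ?_⟩
  calc (y ^ 24) ^ 2 / Q + y ^ 24 * √(f ^ 4 * Q * (3 * y ^ 12))
        + (y ^ 24) ^ 2 * √(3 * y ^ 12 / f ^ 4)
      ≤ 2 * y ^ 44 + y ^ 24 * (2 * (y ^ 8 * f ^ 2)) + (y ^ 24) ^ 2 * (2 * (y ^ 4)⁻¹) := by gcongr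
    _ = 4 * (y ^ 22) ^ 2 + 2 * (y ^ 16 * f) ^ 2 := by field_simp; ring
    _ ≤ (2 * (y ^ 22 + y ^ 16 * f)) ^ 2 := by
        nlinarith [mul_pos (pow_pos hy0 22) (mul_pos (pow_pos hy0 16) hf),
          sq_nonneg (y ^ 16 * f)]

lemma exists_natCast_le_and_le_two_mul {y : ℝ} (hy : 1 ≤ y) :
    ∃ Q : ℕ, 0 < Q ∧ Q ≤ y ∧ y ≤ 2 * Q := by
  have hQ : 1 ≤ ⌊y⌋₊ := Nat.le_floor (mod_cast hy)
  have hQ' : (1 : ℝ) ≤ ⌊y⌋₊ := mod_cast hQ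
  exact ⟨⌊y⌋₊, hQ, Nat.floor_le (by positivity), by linarith [Nat.lt_floor_add_one y]⟩

lemma natLog_two_add_one_le_of_card_divisors_le {Y : ℕ} {D : ℝ} (hY : Y ≠ 0)
    (hD : ∀ n ≤ Y, (#n.divisors : ℝ) ≤ D) : Nat.log 2 Y + 1 ≤ D := by
  simpa only [Nat.divisors_prime_pow Nat.prime_two, card_map, card_range, Nat.cast_succ]
    using hD _ (Nat.pow_log_le_self 2 hY)

lemma norm_sum_typeIICoeff_mul_le {g : ℕ → ℂ} {X Y Q : ℕ} {A₀ F D : ℝ} (hX : 0 < X)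
    (hXY : X ≤ Y) (hY : Y ≤ 3 * X) (hg : ∀ n, ‖g n‖ ≤ 1) (hA₀ : 1 ≤ A₀)
    (hF : (X : ℝ) ^ (11 / 12 : ℝ) ≤ F) (hD : ∀ n ≤ Y, (#n.divisors : ℝ) ≤ D)
    (hII : TypeIIBound g X Y A₀ F) (hQ : 0 < Q) (hQ_le : Q ≤ (X : ℝ) ^ (1 / 6 : ℝ))
    (hle_Q : (X : ℝ) ^ (1 / 6 : ℝ) ≤ 2 * Q) :
    ‖∑ n ∈ Ioc X Y, (((typeIICoeff Q * (Λ - trunc Λ Q)) n : ℝ) : ℂ) * g n‖ ≤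
      28 * A₀ * D ^ 3 *
        ((X : ℝ) ^ (11 / 12 : ℝ) + (X : ℝ) ^ (2 / 3 : ℝ) * F ^ (1 / 4 : ℝ)) := by
  have hX' : (1 : ℝ) ≤ X := mod_cast hX
  have hF0 : 0 < F := hF.trans_lt' (by positivity)
  have hDlog := natLog_two_add_one_le_of_card_divisors_le (hX.trans_le hXY).ne' hD
  have hD0 : 0 ≤ D := hDlog.trans' (by positivity)
  have hlog {n : ℕ} (hn : n ≤ Y) : |(Λ - trunc Λ Q) n| ≤ D :=
    (abs_sub_trunc_le _ _ _).trans <| (abs_of_nonneg vonMangoldt_nonneg).trans_le <|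
      vonMangoldt_le_log.trans <| (log_natCast_le_natLog_add_one hn).trans hDlog
  have hsum := norm_sum_mul_apply_le_of_typeIIBound hQ hY hg hA₀ hF0 hD0
    (fun n hn ↦ (abs_typeIICoeff_le Q n).trans (hD n hn)) (fun n ↦ hlog)
    (fun n ↦ typeIICoeff_eq_zero) (fun n hn ↦ by rw [sub_trunc_apply, if_pos hn]) hII
  set P := (X : ℝ) ^ (11 / 12 : ℝ) + (X : ℝ) ^ (2 / 3 : ℝ) * F ^ (1 / 4 : ℝ)
  calc _ ≤ 2 * ((Nat.log 2 Y + 1) * (7 * A₀ * D * D *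
        √(X ^ 2 / Q + X * √(F * Q * (3 * √X)) + X ^ 2 * √(3 * √X / F)))) := hsum
    _ ≤ 2 * (D * (7 * A₀ * D * D * (2 * P))) := by
        gcongr
        exact sqrt_typeII_le hX' hF (by positivity) hQ_le hle_Q
    _ = 28 * A₀ * D ^ 3 * P := by ring

theorem norm_sum_vonMangoldt_mul_le {g : ℕ → ℂ} {X Y : ℕ} {A₀ F D : ℝ} (hX : 0 < X)
    (hXY : X ≤ Y) (hY : Y ≤ 3 * X) (hg : ∀ n, ‖g n‖ ≤ 1) (hA₀ : 1 ≤ A₀)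
    (hF : (X : ℝ) ^ (11 / 12 : ℝ) ≤ F) (hD : ∀ n ≤ Y, (#n.divisors : ℝ) ≤ D)
    (hI : TypeIBound g X Y (A₀ * (√F + X * (√F)⁻¹))) (hII : TypeIIBound g X Y A₀ F) :
    ‖∑ n ∈ Ioc X Y, (Λ n : ℂ) * g n‖ ≤ 31 * A₀ * D ^ 3 * ((X : ℝ) ^ (11 / 12 : ℝ)
      + (X : ℝ) ^ (2 / 3 : ℝ) * F ^ (1 / 4 : ℝ) + (X : ℝ) ^ (1 / 3 : ℝ) * F ^ (1 / 2 : ℝ)) := by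
  set P₁ := (X : ℝ) ^ (11 / 12 : ℝ)
  set P₂ := (X : ℝ) ^ (2 / 3 : ℝ) * F ^ (1 / 4 : ℝ)
  set P₃ := (X : ℝ) ^ (1 / 3 : ℝ) * F ^ (1 / 2 : ℝ)
  have hX' : (1 : ℝ) ≤ X := mod_cast hX
  have hF0 : 0 < F := hF.trans_lt' (by positivity)
  have hDlog := natLog_two_add_one_le_of_card_divisors_le (hX.trans_le hXY).ne' hD
  have hD1 : 1 ≤ D := hDlog.trans' (by norm_num)
  set T := √F + X * (√F)⁻¹
  have hT : X ^ (1 / 3 : ℝ) * T ≤ P₁ + P₃ := rpow_mul_sqrt_add_le hX' hF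
  obtain ⟨Q, hQ, hQ_le, hle_Q⟩ :=
    exists_natCast_le_and_le_two_mul (Real.one_le_rpow hX' (by norm_num : (0 : ℝ) ≤ 1 / 6))
  have hQQ : (Q : ℝ) * Q ≤ (X : ℝ) ^ (1 / 3 : ℝ) := by
    calc (Q : ℝ) * Q ≤ (X : ℝ) ^ (1 / 6 : ℝ) * (X : ℝ) ^ (1 / 6 : ℝ) := by gcongr
      _ = (X : ℝ) ^ (1 / 3 : ℝ) := by rw [← Real.rpow_add (by positivity)]; norm_num
  have hQX : Q ≤ X := Nat.cast_le.mp (hQ_le.trans (Real.rpow_le_self_of_one_le hX' (by norm_num)))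
  have hsum₁ := norm_sum_trunc_moebius_mul_log_le Q hDlog (by positivity) hI
  have hsum₂ := norm_sum_typeICoeff_mul_zeta_le Q hDlog (by positivity) hI
  have hsum₃ := norm_sum_typeIICoeff_mul_le hX hXY hY hg hA₀ hF hD hII hQ hQ_le hle_Q
  rw [sum_vonMangoldt_mul_eq g hQX]
  refine (norm_add_le_of_le (norm_sub_le_of_le hsum₁ hsum₂) hsum₃).trans ?_
  have hQ' : (1 : ℝ) ≤ Q := mod_cast hQ
  calc Q * (1 * (2 * D * (A₀ * T))) + (Q * Q : ℕ) * (D * (A₀ * T))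
        + 28 * A₀ * D ^ 3 * (P₁ + P₂)
      ≤ (Q * Q) * (1 * (2 * D * (A₀ * T))) + (Q * Q) * (D * (A₀ * T))
        + 28 * A₀ * D ^ 3 * (P₁ + P₂) := by
        push_cast
        gcongr
        exact le_mul_of_one_le_left (by positivity) hQ'
    _ = 3 * A₀ * D * (Q * Q * T) + 28 * A₀ * D ^ 3 * (P₁ + P₂) := by ring
    _ ≤ 3 * A₀ * D ^ 3 * (P₁ + P₃) + 28 * A₀ * D ^ 3 * (P₁ + P₂) := by
        gcongr
        · exact le_self_pow₀ hD1 (by norm_num)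
        · exact (mul_le_mul_of_nonneg_right hQQ (by positivity)).trans hT
    _ ≤ 31 * A₀ * D ^ 3 * (P₁ + P₂ + P₃) := by
        have : 0 ≤ A₀ * D ^ 3 * P₂ := by positivity
        have : 0 ≤ A₀ * D ^ 3 * P₃ := by positivity
        linarith

end Vaughan

section Phase

open Finset Real
open scoped ComplexConjugate FourierTransform

lemma exists_second_difference_eq {f f' f'' : ℝ → ℝ} {a : ℝ}
    (hf : ∀ t ∈ Set.Icc a (a + 2), HasDerivAt f (f' t) t)
    (hf' : ∀ t ∈ Set.Icc a (a + 2), HasDerivAt f' (f'' t) t) :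
    ∃ t ∈ Set.Icc a (a + 2), (f (a + 2) - f (a + 1)) - (f (a + 1) - f a) = f'' t := by
  have hdiff {t : ℝ} (ht : t ∈ Set.Icc a (a + 1)) :
      HasDerivAt (fun u ↦ f (u + 1) - f u) (f' (t + 1) - f' t) t :=
    ((hf (t + 1) ⟨by linarith [ht.1], by linarith [ht.2]⟩).comp_add_const t 1).sub
      (hf t ⟨ht.1, by linarith [ht.2]⟩)
  obtain ⟨c, ⟨hac, hca⟩, hc⟩ := exists_hasDerivAt_eq_slope _ _ (lt_add_one a)
    (fun t ht ↦ (hdiff ht).continuousAt.continuousWithinAt)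
    (fun t ht ↦ hdiff (Set.Ioo_subset_Icc_self ht))
  have hsub : Set.Icc c (c + 1) ⊆ Set.Icc a (a + 2) := Set.Icc_subset_Icc hac.le (by linarith)
  obtain ⟨d, hd, hd'⟩ := exists_hasDerivAt_eq_slope f' f'' (lt_add_one c)
    (fun t ht ↦ (hf' t (hsub ht)).continuousAt.continuousWithinAt)
    (fun t ht ↦ hf' t (hsub (Set.Ioo_subset_Icc_self ht)))
  refine ⟨d, hsub (Set.Ioo_subset_Icc_self hd), ?_⟩
  simp only [add_sub_cancel_left, div_one] at hc hd'
  rw [hd', hc]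
  ring_nf

theorem van_der_corput_of_hasDerivAt {f f' f'' : ℝ → ℝ} {a b : ℕ} {l C : ℝ} (hl : 0 < l)
    (hC : 1 ≤ C) (hf : ∀ t ∈ Set.Icc ((a : ℝ) + 1) (b + 1), HasDerivAt f (f' t) t)
    (hf' : ∀ t ∈ Set.Icc ((a : ℝ) + 1) (b + 1), HasDerivAt f' (f'' t) t)
    (hf'' : ∀ t ∈ Set.Icc ((a : ℝ) + 1) (b + 1), f'' t ∈ Set.Icc l (C * l)) :
    ‖∑ n ∈ Ioc a b, (𝐞 (f n) : ℂ)‖ ≤ 8 * C * (b * √l + (√l)⁻¹) := by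
  rcases le_total b a with hba | hab
  · rw [Ioc_eq_empty_of_le hba, sum_empty, norm_zero]
    positivity
  have hdiff (n : ℕ) (hn : a + 1 ≤ n) (hnb : n + 1 < b + 1) :
      (f (n + 2 : ℕ) - f (n + 1 : ℕ)) - (f (n + 1 : ℕ) - f n) ∈ Set.Icc l (C * l) := by
    have hsub : Set.Icc (n : ℝ) (n + 2) ⊆ Set.Icc ((a : ℝ) + 1) (b + 1) :=
      Set.Icc_subset_Icc (mod_cast hn) (mod_cast (by lia : n + 2 ≤ b + 1))
    obtain ⟨t, ht, heq⟩ := exists_second_difference_eq (a := n)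
      (fun t ht ↦ hf t (hsub ht)) (fun t ht ↦ hf' t (hsub ht))
    push_cast
    exact heq ▸ hf'' t (hsub ht)
  rw [← Ico_add_one_add_one_eq_Ioc]
  refine (van_der_corput hl hC (Nat.succ_le_succ hab) hdiff).trans ?_
  push_cast
  gcongr
  linarith [Nat.cast_nonneg (α := ℝ) a]

/-- The phase of the exponential sums over primes: the first term comes from a Fourier expansion
of the sawtooth function at `-(p - β) ^ γ`, the second one from detecting a residue class. -/
noncomputable def phase (r β γ θ u : ℝ) : ℝ := -(r * (u - β) ^ γ) + θ * u

lemma hasDerivAt_mul_sub_rpow {β y t : ℝ} (s : ℝ) (h : 0 < y * t - β) :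
    HasDerivAt (fun t ↦ (y * t - β) ^ s) (s * y * (y * t - β) ^ (s - 1)) t := by
  have hlin : HasDerivAt (fun t ↦ y * t - β) y t := by
    simpa only [mul_one] using ((hasDerivAt_id' t).const_mul y).sub_const β
  convert! hlin.rpow_const (p := s) (Or.inl h.ne') using 1
  ring

lemma hasDerivAt_phase (r β γ θ : ℝ) {y t : ℝ} (h : 0 < y * t - β) :
    HasDerivAt (fun t ↦ phase r β γ θ (y * t))
      (-(r * (γ * y * (y * t - β) ^ (γ - 1))) + θ * y) t := by
  have hlin : HasDerivAt (fun t ↦ θ * (y * t)) (θ * y) t := by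
    simpa only [mul_one] using ((hasDerivAt_id' t).const_mul y).const_mul θ
  exact ((hasDerivAt_mul_sub_rpow γ h).const_mul r).neg.add hlin

lemma hasDerivAt_deriv_phase (r β γ θ : ℝ) {y t : ℝ} (h : 0 < y * t - β) :
    HasDerivAt (fun t ↦ -(r * (γ * y * (y * t - β) ^ (γ - 1))) + θ * y)
      (r * γ * (1 - γ) * (y ^ 2 * (y * t - β) ^ (γ - 2))) t := by
  convert! (((hasDerivAt_mul_sub_rpow (γ - 1) h).const_mul (γ * y)).const_mul r).neg.add_const
    (θ * y) using 1
  rw [show γ - 1 - 1 = γ - 2 by ring]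
  ring

lemma hasDerivAt_sq_mul_sub_rpow (γ : ℝ) {β y t : ℝ} (h : 0 < y * t - β) :
    HasDerivAt (fun y ↦ y ^ 2 * (y * t - β) ^ (γ - 2))
      (y * (y * t - β) ^ (γ - 3) * (γ * (y * t) - 2 * β)) y := by
  have hrpow := hasDerivAt_mul_sub_rpow (γ - 2) ((mul_comm t y).symm ▸ h)
  simp only [mul_comm t] at hrpow
  convert! (hasDerivAt_pow 2 y).mul hrpow using 1
  rw [show γ - 2 = γ - 3 + 1 by ring, rpow_add_one h.ne', show γ - 3 + 1 - 1 = γ - 3 by ring]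
  push_cast
  ring

lemma rpow_mem_Icc_of_mem_Icc {x v s : ℝ} {k : ℕ} (hx : 0 < x) (hv : v ∈ Set.Icc (x / 2) (7 * x))
    (hs : s ∈ Set.Icc (-k : ℝ) 0) : v ^ s ∈ Set.Icc (x ^ s / 7 ^ k) (2 ^ k * x ^ s) := by
  have hv0 : 0 < v := hv.1.trans_lt' (by positivity)
  constructor
  · calc x ^ s / 7 ^ k = 7 ^ (-k : ℝ) * x ^ s := by
          rw [rpow_neg (by norm_num), rpow_natCast]
          ring
      _ ≤ 7 ^ s * x ^ s := by
          gcongr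
          exacts [by norm_num, hs.1]
      _ = (7 * x) ^ s := (mul_rpow (by norm_num) hx.le).symm
      _ ≤ v ^ s := rpow_le_rpow_of_nonpos hv0 hv.2 hs.2
  · calc v ^ s ≤ (x / 2) ^ s := rpow_le_rpow_of_nonpos (by positivity) hv.1 hs.2
      _ = 2 ^ (-s) * x ^ s := by
          rw [div_rpow hx.le (by norm_num), rpow_neg (by norm_num)]
          ring
      _ ≤ 2 ^ (k : ℝ) * x ^ s := by
          gcongr
          exacts [by norm_num, neg_le.mp hs.1]
      _ = 2 ^ k * x ^ s := by rw [rpow_natCast]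

lemma sub_mem_Icc_of_mem_Icc {x u β : ℝ} (hβ : 2 * |β| ≤ x) (hu : u ∈ Set.Icc x (6 * x)) :
    u - β ∈ Set.Icc (x / 2) (7 * x) := by
  constructor <;> linarith [hu.1, hu.2, le_abs_self β, neg_abs_le β, abs_nonneg β]

lemma natCast_le_mul_of_div_add_one_le {X m : ℕ} {t : ℝ} (hm : 0 < m)
    (ht : ((X / m : ℕ) : ℝ) + 1 ≤ t) : (X : ℝ) ≤ m * t :=
  calc (X : ℝ) ≤ m * ((X / m : ℕ) + 1) := mod_cast (Nat.lt_mul_div_succ X hm).le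
    _ ≤ m * t := by gcongr

lemma mul_le_two_mul_of_le_div_add_one {Y m : ℕ} {t : ℝ} (hm : m ≤ Y)
    (ht : t ≤ ((Y / m : ℕ) : ℝ) + 1) : m * t ≤ 2 * Y :=
  calc m * t ≤ m * ((Y / m : ℕ) + 1) := by gcongr
    _ ≤ 2 * Y := mod_cast (by linarith [Nat.mul_div_le Y m] : m * (Y / m + 1) ≤ 2 * Y)

lemma mul_sqrt_add_inv_sqrt_le {b k x c F : ℝ} (hk : 0 < k) (hx : 0 < x) (hc : 0 < c)
    (hF : 0 < F) (hb : b * k ≤ 3 * x) :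
    b * √(c * F * (k / x) ^ 2) + (√(c * F * (k / x) ^ 2))⁻¹ ≤
      (3 * √c + (√c)⁻¹) * (√F + x / k * (√F)⁻¹) := by
  have hsqrt : √(c * F * (k / x) ^ 2) = √c * √F * (k / x) := by
    rw [sqrt_mul (by positivity), sqrt_sq (by positivity), sqrt_mul hc.le]
  have : 0 < √c := sqrt_pos.mpr hc
  have : 0 < √F := sqrt_pos.mpr hF
  calc b * √(c * F * (k / x) ^ 2) + (√(c * F * (k / x) ^ 2))⁻¹
      = √c * √F * (b * k) / x + (√c)⁻¹ * (x / k * (√F)⁻¹) := by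
        rw [hsqrt]
        field_simp
    _ ≤ √c * √F * (3 * x) / x + (√c)⁻¹ * (x / k * (√F)⁻¹) := by gcongr
    _ = 3 * √c * √F + (√c)⁻¹ * (x / k * (√F)⁻¹) := by field_simp
    _ ≤ 3 * √c * √F + (√c)⁻¹ * (x / k * (√F)⁻¹) +
        (3 * √c * (x / k * (√F)⁻¹) + (√c)⁻¹ * √F) := le_add_of_nonneg_right (by positivity)
    _ = (3 * √c + (√c)⁻¹) * (√F + x / k * (√F)⁻¹) := by ring

lemma TypeIBound.mono {g : ℕ → ℂ} {X Y : ℕ} {T T' : ℝ} (h : TypeIBound g X Y T) (hT : T ≤ T') :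
    TypeIBound g X Y T' := fun m hm b hb ↦ (h m hm b hb).trans hT

lemma TypeIIBound.mono {g : ℕ → ℂ} {X Y : ℕ} {A A' F : ℝ} (h : TypeIIBound g X Y A F)
    (hA : A ≤ A') : TypeIIBound g X Y A' F := fun K n₁ h₁ n₂ h₂ hlt ↦
  (h K n₁ h₁ n₂ h₂ hlt).trans (by gcongr)

lemma rpow_sub_two_eq {x : ℝ} (hx : 0 < x) (γ : ℝ) : x ^ (γ - 2) = x ^ γ / x ^ 2 := by
  rw [rpow_sub hx, rpow_two]

lemma norm_sum_phase_le {x r β γ θ y : ℝ} {a b : ℕ} (hx : 0 < x) (hr : 0 < r)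
    (hγ : γ ∈ Set.Ioo 0 1) (hy : 0 < y)
    (hv : ∀ t ∈ Set.Icc ((a : ℝ) + 1) (b + 1), y * t - β ∈ Set.Icc (x / 2) (7 * x)) :
    ‖∑ n ∈ Ioc a b, (𝐞 (phase r β γ θ (y * n)) : ℂ)‖ ≤
      8 * 196 * (b * √(r * γ * (1 - γ) * (y ^ 2 * (x ^ (γ - 2) / 7 ^ 2))) +
        (√(r * γ * (1 - γ) * (y ^ 2 * (x ^ (γ - 2) / 7 ^ 2))))⁻¹) := by
  have hγ0 : 0 < γ := hγ.1
  have hγ1 : 0 < 1 - γ := sub_pos.mpr hγ.2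
  have hv0 (t : ℝ) (ht : t ∈ Set.Icc ((a : ℝ) + 1) (b + 1)) : 0 < y * t - β :=
    (hv t ht).1.trans_lt' (by positivity)
  refine van_der_corput_of_hasDerivAt (f := fun t ↦ phase r β γ θ (y * t)) (by positivity)
    (by norm_num) (fun t ht ↦ hasDerivAt_phase r β γ θ (hv0 t ht))
    (fun t ht ↦ hasDerivAt_deriv_phase r β γ θ (hv0 t ht)) fun t ht ↦ ?_
  obtain ⟨hlow, hupp⟩ := rpow_mem_Icc_of_mem_Icc (s := γ - 2) (k := 2) hx (hv t ht)
    ⟨by push_cast; linarith, by linarith⟩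
  refine ⟨by gcongr, ?_⟩
  calc r * γ * (1 - γ) * (y ^ 2 * (y * t - β) ^ (γ - 2))
      ≤ r * γ * (1 - γ) * (y ^ 2 * (2 ^ 2 * x ^ (γ - 2))) := by gcongr
    _ = 196 * (r * γ * (1 - γ) * (y ^ 2 * (x ^ (γ - 2) / 7 ^ 2))) := by ring

theorem exists_typeIBound_phase {κ β γ : ℝ} (hκ : 0 < κ) (hγ : γ ∈ Set.Ioo 0 1) :
    ∃ A : ℝ, ∀ (X Y : ℕ) (h θ : ℝ), 2 * |β| ≤ X → Y ≤ 3 * X → 0 < h →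
      TypeIBound (fun n ↦ (𝐞 (phase (κ * h) β γ θ n) : ℂ)) X Y
        (A * (√(h * (X : ℝ) ^ γ) + X * (√(h * (X : ℝ) ^ γ))⁻¹)) := by
  have hγ0 : 0 < γ := hγ.1
  have hγ1 : 0 < 1 - γ := sub_pos.mpr hγ.2
  set c := κ * γ * (1 - γ) / 49
  have hc : 0 < c := by positivity
  refine ⟨8 * 196 * (3 * √c + (√c)⁻¹), fun X Y h θ hβ hY hh m hm b hb ↦ ?_⟩
  obtain ⟨hm0, hmY⟩ := mem_Ioc.mp hm
  have hm1 : (1 : ℝ) ≤ m := mod_cast hm0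
  have hX : (0 : ℝ) < X := mod_cast (by lia : 0 < X)
  have hY' : (Y : ℝ) ≤ 3 * X := mod_cast hY
  set F := h * (X : ℝ) ^ γ
  have hF : 0 < F := by positivity
  have hbY : (b : ℝ) ≤ (Y / m : ℕ) := mod_cast (mem_Icc.mp hb).2
  have hv (t : ℝ) (ht : t ∈ Set.Icc (((X / m : ℕ) : ℝ) + 1) (b + 1)) :
      m * t - β ∈ Set.Icc ((X : ℝ) / 2) (7 * X) :=
    sub_mem_Icc_of_mem_Icc hβ ⟨natCast_le_mul_of_div_add_one_le hm0 ht.1,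
      (mul_le_two_mul_of_le_div_add_one hmY (by linarith [ht.2])).trans (by linarith)⟩
  have hbm : (b : ℝ) * m ≤ 3 * X :=
    mod_cast ((Nat.le_div_iff_mul_le hm0).mp (mem_Icc.mp hb).2).trans hY
  have hl : κ * h * γ * (1 - γ) * (m ^ 2 * ((X : ℝ) ^ (γ - 2) / 7 ^ 2)) =
      c * F * (m / X) ^ 2 := by
    rw [rpow_sub_two_eq hX]
    ring
  simp only [Nat.cast_mul]
  refine (norm_sum_phase_le hX (by positivity) hγ (by positivity) hv).trans ?_
  rw [hl]
  calc _ ≤ 8 * 196 * ((3 * √c + (√c)⁻¹) * (√F + X / m * (√F)⁻¹)) := by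
        gcongr
        exact mul_sqrt_add_inv_sqrt_le (by positivity) hX hc hF hbm
    _ ≤ 8 * 196 * (3 * √c + (√c)⁻¹) * (√F + X * (√F)⁻¹) := by
        rw [← mul_assoc]
        gcongr
        exact div_le_self hX.le hm1

lemma deriv_sq_mul_sub_rpow_mem_Icc {x y t β γ K : ℝ} (hx : 0 < x) (hγ : γ ∈ Set.Ioo 0 1)
    (hβ : 4 * |β| ≤ γ * x) (hK : 0 < K) (hy : y ∈ Set.Icc K (2 * K))
    (hyt : y * t ∈ Set.Icc x (6 * x)) :
    y * (y * t - β) ^ (γ - 3) * (γ * (y * t) - 2 * β) ∈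
      Set.Icc (γ / 686 * (K * x ^ (γ - 2))) (112 * (K * x ^ (γ - 2))) := by
  have hγ0 : 0 < γ := hγ.1
  have hγx : γ * x ≤ x := mul_le_of_le_one_left hx.le hγ.2.le
  have hβ' := abs_le.mp ((le_div_iff₀' (by norm_num)).mpr hβ)
  have hv := sub_mem_Icc_of_mem_Icc (β := β) (by linarith [abs_nonneg β]) hyt
  have hv0 : 0 < y * t - β := hv.1.trans_lt' (by positivity)
  obtain ⟨hlow, hupp⟩ := rpow_mem_Icc_of_mem_Icc (s := γ - 3) (k := 3) hx hv
    ⟨by push_cast; linarith, by linarith [hγ.2]⟩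
  have hpow : x ^ (γ - 2) = x ^ (γ - 3) * x := by
    rw [← rpow_add_one hx.ne', show γ - 3 + 1 = γ - 2 by ring]
  have hγyt : γ * x ≤ γ * (y * t) := mul_le_mul_of_nonneg_left hyt.1 hγ0.le
  have hγyt' : γ * (y * t) ≤ y * t := mul_le_of_le_one_left (hx.le.trans hyt.1) hγ.2.le
  have hlin : γ / 2 * x ≤ γ * (y * t) - 2 * β := by linarith
  have hlin' : γ * (y * t) - 2 * β ≤ 7 * x := by linarith [hyt.2]
  have hy0 : 0 < y := hK.trans_le hy.1
  rw [hpow]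
  constructor
  · calc γ / 686 * (K * (x ^ (γ - 3) * x)) = K * (x ^ (γ - 3) / 7 ^ 3) * (γ / 2 * x) := by ring
      _ ≤ y * (y * t - β) ^ (γ - 3) * (γ * (y * t) - 2 * β) := by
        gcongr
        exact hy.1
  · calc y * (y * t - β) ^ (γ - 3) * (γ * (y * t) - 2 * β)
        ≤ 2 * K * (2 ^ 3 * x ^ (γ - 3)) * (7 * x) := by
          gcongr
          exacts [hlin.trans' (by positivity), hy.2]
      _ = 112 * (K * (x ^ (γ - 3) * x)) := by ring

lemma sq_mul_sub_rpow_sub_mem_Icc {x y₁ y₂ t β γ K : ℝ} (hx : 0 < x) (hγ : γ ∈ Set.Ioo 0 1)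
    (hβ : 4 * |β| ≤ γ * x) (hK : 0 < K) (ht : 0 ≤ t) (hy : y₂ < y₁) (hKy : K ≤ y₂)
    (hyK : y₁ ≤ 2 * K) (hxy : x ≤ y₂ * t) (hyx : y₁ * t ≤ 6 * x) :
    y₁ ^ 2 * (y₁ * t - β) ^ (γ - 2) - y₂ ^ 2 * (y₂ * t - β) ^ (γ - 2) ∈
      Set.Icc (γ / 686 * (K * x ^ (γ - 2)) * (y₁ - y₂)) (112 * (K * x ^ (γ - 2)) * (y₁ - y₂)) := by
  have hyt {y : ℝ} (hy : y ∈ Set.Icc y₂ y₁) : y * t ∈ Set.Icc x (6 * x) :=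
    ⟨hxy.trans (by gcongr; exact hy.1), hyx.trans' (by gcongr; exact hy.2)⟩
  have hderiv {y : ℝ} (hy : y ∈ Set.Icc y₂ y₁) := hasDerivAt_sq_mul_sub_rpow (β := β) (t := t) γ
    (show 0 < y * t - β by
      have := mul_le_of_le_one_left hx.le hγ.2.le
      linarith [(hyt hy).1, le_abs_self β, abs_nonneg β])
  obtain ⟨y, hy₀, hslope⟩ := exists_hasDerivAt_eq_slope _ _ hy
    (fun y hy ↦ (hderiv hy).continuousAt.continuousWithinAt)
    (fun y hy ↦ hderiv (Set.Ioo_subset_Icc_self hy))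
  have hy₀ := Set.Ioo_subset_Icc_self hy₀
  have hpos : 0 < y₁ - y₂ := sub_pos.mpr hy
  obtain ⟨hlow, hupp⟩ := deriv_sq_mul_sub_rpow_mem_Icc hx hγ hβ hK
    ⟨hKy.trans hy₀.1, hy₀.2.trans hyK⟩ (hyt hy₀)
  rw [hslope] at hlow hupp
  exact ⟨(le_div_iff₀ hpos).mp hlow, (div_le_iff₀ hpos).mp hupp⟩

lemma norm_sum_phase_sub_phase_le {x r β γ θ y₁ y₂ K : ℝ} {a b : ℕ} (hx : 0 < x) (hr : 0 < r)
    (hγ : γ ∈ Set.Ioo 0 1) (hβ : 4 * |β| ≤ γ * x) (hK : 0 < K) (hy : y₂ < y₁) (hKy : K ≤ y₂)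
    (hyK : y₁ ≤ 2 * K) (hlow : ∀ t ∈ Set.Icc ((a : ℝ) + 1) (b + 1), x ≤ y₂ * t)
    (hupp : ∀ t ∈ Set.Icc ((a : ℝ) + 1) (b + 1), y₁ * t ≤ 6 * x) :
    ‖∑ n ∈ Ioc a b, (𝐞 (phase r β γ θ (y₁ * n) - phase r β γ θ (y₂ * n)) : ℂ)‖ ≤
      8 * (112 * (686 / γ)) *
        (b * √(r * γ * (1 - γ) * (γ / 686 * (K * x ^ (γ - 2)) * (y₁ - y₂))) +
          (√(r * γ * (1 - γ) * (γ / 686 * (K * x ^ (γ - 2)) * (y₁ - y₂))))⁻¹) := by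
  have hγ0 : 0 < γ := hγ.1
  have hγ1 : 0 < 1 - γ := sub_pos.mpr hγ.2
  have hy' : 0 < y₁ - y₂ := sub_pos.mpr hy
  have ht0 {t : ℝ} (ht : t ∈ Set.Icc ((a : ℝ) + 1) (b + 1)) : 0 ≤ t := ht.1.trans' (by positivity)
  have hv (t : ℝ) (ht : t ∈ Set.Icc ((a : ℝ) + 1) (b + 1)) : 0 < y₁ * t - β ∧ 0 < y₂ * t - β := by
    have := mul_le_mul_of_nonneg_right hy.le (ht0 ht)
    have := mul_le_of_le_one_left hx.le hγ.2.le
    constructor <;> linarith [hlow t ht, le_abs_self β, abs_nonneg β]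
  refine van_der_corput_of_hasDerivAt
    (f := fun t ↦ phase r β γ θ (y₁ * t) - phase r β γ θ (y₂ * t)) (by positivity)
    (by rw [← mul_div_assoc, one_le_div hγ0]; linarith [hγ.2])
    (fun t ht ↦ (hasDerivAt_phase r β γ θ (hv t ht).1).sub
      (hasDerivAt_phase r β γ θ (hv t ht).2))
    (fun t ht ↦ (hasDerivAt_deriv_phase r β γ θ (hv t ht).1).sub
      (hasDerivAt_deriv_phase r β γ θ (hv t ht).2)) fun t ht ↦ ?_
  obtain ⟨hΔ, hΔ'⟩ :=
    sq_mul_sub_rpow_sub_mem_Icc hx hγ hβ hK (ht0 ht) hy hKy hyK (hlow t ht) (hupp t ht)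
  rw [← mul_sub]
  refine ⟨by gcongr, ?_⟩
  calc r * γ * (1 - γ) * (y₁ ^ 2 * (y₁ * t - β) ^ (γ - 2) - y₂ ^ 2 * (y₂ * t - β) ^ (γ - 2))
      ≤ r * γ * (1 - γ) * (112 * (K * x ^ (γ - 2)) * (y₁ - y₂)) := by gcongr
    _ = 112 * (686 / γ) * (r * γ * (1 - γ) * (γ / 686 * (K * x ^ (γ - 2)) * (y₁ - y₂))) := by
      field_simp

lemma fourierChar_mul_conj_fourierChar (s t : ℝ) :
    (𝐞 s : ℂ) * conj (𝐞 t : ℂ) = (𝐞 (s - t) : ℂ) := by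
  rw [AddChar.map_sub_eq_div, Circle.coe_div, div_eq_mul_inv, ← Circle.coe_inv_eq_conj,
    Circle.coe_inv]

theorem exists_typeIIBound_phase {κ β γ : ℝ} (hκ : 0 < κ) (hγ : γ ∈ Set.Ioo 0 1) :
    ∃ A : ℝ, ∀ (X Y : ℕ) (h θ : ℝ), 4 * |β| ≤ γ * X → Y ≤ 3 * X → 0 < h →
      TypeIIBound (fun n ↦ (𝐞 (phase (κ * h) β γ θ n) : ℂ)) X Y A (h * (X : ℝ) ^ γ) := by
  have hγ0 : 0 < γ := hγ.1
  have hγ1 : 0 < 1 - γ := sub_pos.mpr hγ.2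
  set c := κ * γ * (1 - γ) * (γ / 686)
  have hc : 0 < c := by positivity
  refine ⟨8 * (112 * (686 / γ)) * (3 * √c + (√c)⁻¹), fun X Y h θ hβ hY hh K n₁ h₁ n₂ h₂ hlt ↦ ?_⟩
  set a := max (X / n₁) (X / n₂)
  set b := min (Y / n₁) (Y / n₂)
  simp only [fourierChar_mul_conj_fourierChar, Nat.cast_mul]
  obtain ⟨hK₁, h₁K⟩ := mem_Ico.mp h₁
  obtain ⟨hK₂, h₂K⟩ := mem_Ico.mp h₂
  rcases b.eq_zero_or_pos with hb0 | hb0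
  · rw [hb0, Ioc_eq_empty_of_le (Nat.zero_le _), sum_empty, norm_zero]
    positivity
  have hn₁Y : n₁ ≤ Y := by
    by_contra hn₁Y
    exact hb0.ne' (Nat.le_zero.mp ((min_le_left _ _).trans_eq (Nat.div_eq_of_lt (by lia))))
  have hX : (0 : ℝ) < X := mod_cast (by lia : 0 < X)
  have hK : (0 : ℝ) < K := mod_cast (by lia : 0 < K)
  have hY' : (Y : ℝ) ≤ 3 * X := mod_cast hY
  have hlt' : (n₂ : ℝ) < n₁ := mod_cast hlt
  have hpos : (0 : ℝ) < n₁ - n₂ := sub_pos.mpr hlt'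
  have hlow (t : ℝ) (ht : t ∈ Set.Icc ((a : ℝ) + 1) (b + 1)) : (X : ℝ) ≤ n₂ * t :=
    natCast_le_mul_of_div_add_one_le (by lia)
      (ht.1.trans' (mod_cast Nat.succ_le_succ (le_max_right _ _)))
  have hupp (t : ℝ) (ht : t ∈ Set.Icc ((a : ℝ) + 1) (b + 1)) : n₁ * t ≤ 6 * X :=
    (mul_le_two_mul_of_le_div_add_one hn₁Y
      (ht.2.trans (mod_cast Nat.succ_le_succ (min_le_left _ _)))).trans (by linarith)
  set F := h * (X : ℝ) ^ γ * (n₁ - n₂) / K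
  have hF : 0 < F := by positivity
  have hl : κ * h * γ * (1 - γ) * (γ / 686 * (K * (X : ℝ) ^ (γ - 2)) * (n₁ - n₂)) =
      c * F * (K / X) ^ 2 := by
    rw [rpow_sub_two_eq hX]
    simp only [c, F]
    field_simp
  have hbK : (b : ℝ) * K ≤ 3 * X := mod_cast
    (Nat.mul_le_mul_left b hK₁).trans
      (((Nat.le_div_iff_mul_le (by lia)).mp (min_le_left _ _)).trans hY)
  refine (norm_sum_phase_sub_phase_le hX (by positivity) hγ hβ hK hlt' (mod_cast hK₂)
    (mod_cast h₁K.le) hlow hupp).trans ?_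
  rw [hl, mul_assoc _ (_ + _)]
  gcongr
  exact mul_sqrt_add_inv_sqrt_le hK hX hc hF hbK

end Phase

section Primes

open Finset Real
open ArithmeticFunction hiding log
open scoped FourierTransform

lemma norm_sum_not_prime_vonMangoldt_mul_le {g : ℕ → ℂ} {k : ℕ} (X : ℕ) (hk : 1 ≤ k)
    (hg : ∀ n, ‖g n‖ ≤ 1) :
    ‖∑ n ∈ Ioc X k with ¬ n.Prime, (Λ n : ℂ) * g n‖ ≤ 2 * √k * log k :=
  calc ‖∑ n ∈ Ioc X k with ¬ n.Prime, (Λ n : ℂ) * g n‖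
      ≤ ∑ n ∈ Ioc X k with ¬ n.Prime, Λ n := norm_sum_le_of_le _ fun n _ ↦ by
        rw [norm_mul, Complex.norm_real, norm_of_nonneg vonMangoldt_nonneg]
        exact mul_le_of_le_one_right vonMangoldt_nonneg (hg n)
    _ ≤ ∑ n ∈ Ioc 0 k with ¬ n.Prime, Λ n := sum_le_sum_of_subset_of_nonneg
        (filter_subset_filter _ (Ioc_subset_Ioc_left X.zero_le)) fun _ _ _ ↦ vonMangoldt_nonneg
    _ = Chebyshev.psi k - Chebyshev.theta k := by
        rw [Chebyshev.psi_sub_theta_eq_sum_not_prime, Nat.floor_natCast]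
    _ ≤ 2 * √k * log k := Chebyshev.psi_sub_theta_le (mod_cast hk)

lemma norm_sum_primes_log_mul_le {g : ℕ → ℂ} {X k : ℕ} (hk : 1 ≤ k) (hg : ∀ n, ‖g n‖ ≤ 1) :
    ‖∑ n ∈ Ioc X k, if n.Prime then (log n : ℂ) * g n else 0‖ ≤
      ‖∑ n ∈ Ioc X k, (Λ n : ℂ) * g n‖ + 2 * √k * log k := by
  have hsplit : (∑ n ∈ Ioc X k, if n.Prime then (log n : ℂ) * g n else 0) =
      ∑ n ∈ Ioc X k, (Λ n : ℂ) * g n - ∑ n ∈ Ioc X k with ¬ n.Prime, (Λ n : ℂ) * g n := by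
    rw [sum_filter, ← sum_sub_distrib]
    refine sum_congr rfl fun n _ ↦ ?_
    by_cases hn : n.Prime
    · simp only [hn, if_true, not_true_eq_false, if_false, sub_zero, vonMangoldt_apply_prime hn]
    · simp only [hn, if_false, not_false_eq_true, if_true, sub_self]
  rw [hsplit]
  exact norm_sub_le_of_le le_rfl (norm_sum_not_prime_vonMangoldt_mul_le X hk hg)

lemma norm_sum_primes_le_of_norm_sum_vonMangoldt_mul_le {g : ℕ → ℂ} {X Y : ℕ} {B : ℝ}
    (hX : 1 ≤ X) (hXY : X ≤ Y) (hg : ∀ n, ‖g n‖ ≤ 1)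
    (hB : ∀ k ∈ Icc X Y, ‖∑ n ∈ Ioc X k, (Λ n : ℂ) * g n‖ ≤ B) :
    ‖∑ p ∈ Ioc X Y with p.Prime, g p‖ ≤ 4 * (B + 2 * √Y * log Y) := by
  have hB0 : 0 ≤ B := (norm_nonneg _).trans (hB X (left_mem_Icc.mpr hXY))
  have hlog2 {n : ℕ} (hn : X < n) : 2⁻¹ ≤ log n := by
    have : log 2 ≤ log n := log_le_log two_pos (mod_cast (by lia : 2 ≤ n))
    linarith [log_two_gt_d9]
  have hweight : ∑ p ∈ Ioc X Y with p.Prime, g p = ∑ n ∈ Ioc X Y, (((log n)⁻¹ : ℝ) : ℂ) *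
      if n.Prime then (log n : ℂ) * g n else 0 := by
    rw [sum_filter]
    refine sum_congr rfl fun n hn ↦ ?_
    have : log n ≠ 0 := ((hlog2 (mem_Ioc.mp hn).1).trans_lt' (by norm_num)).ne'
    split_ifs
    · rw [← mul_assoc, ← Complex.ofReal_mul, inv_mul_cancel₀ this, Complex.ofReal_one, one_mul]
    · rw [mul_zero]
  rw [hweight]
  refine (norm_sum_Ioc_mul_le_of_monotoneOn_or_antitoneOn (W := 2) (.inr fun m hm n _ hmn ↦ ?_)
    (fun n hn ↦ ⟨by positivity, ?_⟩) two_pos.le (fun k hk ↦ ?_) (by positivity)).trans_eq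
    (by ring : 2 * 2 * (B + 2 * √Y * log Y) = _)
  · exact inv_anti₀ ((hlog2 hm.1).trans_lt' (by norm_num))
      (log_le_log (mod_cast hm.1.pos) (mod_cast hmn))
  · exact inv_le_of_inv_le₀ two_pos (hlog2 (mem_Ioc.mp hn).1)
  · obtain ⟨hXk, hkY⟩ := mem_Icc.mp hk
    refine (norm_sum_primes_log_mul_le (hX.trans hXk) hg).trans ?_
    have : (0 : ℝ) < k := mod_cast hX.trans hXk
    gcongr
    exact hB k hk

lemma exists_card_divisors_le_of_le_three_mul {s : ℝ} (hs : 0 < s) :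
    ∃ C : ℝ, 0 < C ∧ ∀ X n : ℕ, n ≤ 3 * X → (#n.divisors : ℝ) ≤ C * (X : ℝ) ^ s := by
  obtain ⟨C, hC, hdiv⟩ := exists_card_divisors_le_rpow hs
  refine ⟨C * 3 ^ s, by positivity, fun X n hn ↦ ?_⟩
  rcases eq_or_ne n 0 with rfl | hn0
  · rw [Nat.divisors_zero, card_empty, Nat.cast_zero]
    positivity
  calc (#n.divisors : ℝ) ≤ C * (n : ℝ) ^ s := hdiv n hn0
    _ ≤ C * (3 * X : ℝ) ^ s := by
        gcongr
        exact mod_cast hn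
    _ = C * 3 ^ s * (X : ℝ) ^ s := by
        rw [mul_rpow (by norm_num) X.cast_nonneg, mul_assoc]

lemma sqrt_natCast_le_of_le_three_mul {X Y : ℕ} (hX : 1 ≤ X) (hY : Y ≤ 3 * X) :
    √(Y : ℝ) ≤ 2 * (X : ℝ) ^ (11 / 12 : ℝ) :=
  calc √(Y : ℝ) ≤ √(2 ^ 2 * X) := sqrt_le_sqrt (mod_cast (by lia : Y ≤ 2 ^ 2 * X))
    _ = 2 * (X : ℝ) ^ (1 / 2 : ℝ) := by
        rw [sqrt_mul (by norm_num), sqrt_sq two_pos.le, sqrt_eq_rpow]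
    _ ≤ 2 * (X : ℝ) ^ (11 / 12 : ℝ) := mul_le_mul_of_nonneg_left
        (rpow_le_rpow_of_exponent_le (mod_cast hX) (by norm_num)) two_pos.le

theorem norm_sum_primes_le_of_typeIBound_typeIIBound {g : ℕ → ℂ} {X Y : ℕ} {A F D : ℝ}
    (hX : 1 ≤ X) (hXY : X ≤ Y) (hY : Y ≤ 3 * X) (hg : ∀ n, ‖g n‖ ≤ 1) (hA : 1 ≤ A)
    (hF : (X : ℝ) ^ (11 / 12 : ℝ) ≤ F) (hD : ∀ n ≤ Y, (#n.divisors : ℝ) ≤ D)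
    (hI : ∀ k ∈ Icc X Y, TypeIBound g X k (A * (√F + X * (√F)⁻¹)))
    (hII : ∀ k ∈ Icc X Y, TypeIIBound g X k A F) :
    ‖∑ p ∈ Ioc X Y with p.Prime, g p‖ ≤ 140 * A * D ^ 3 * ((X : ℝ) ^ (11 / 12 : ℝ)
      + (X : ℝ) ^ (2 / 3 : ℝ) * F ^ (1 / 4 : ℝ) + (X : ℝ) ^ (1 / 3 : ℝ) * F ^ (1 / 2 : ℝ)) := by
  have hF0 : 0 ≤ F := hF.trans' (by positivity)
  set P := (X : ℝ) ^ (11 / 12 : ℝ) + (X : ℝ) ^ (2 / 3 : ℝ) * F ^ (1 / 4 : ℝ) +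
    (X : ℝ) ^ (1 / 3 : ℝ) * F ^ (1 / 2 : ℝ) with hP
  have hΛ (k : ℕ) (hk : k ∈ Icc X Y) :
      ‖∑ n ∈ Ioc X k, (Λ n : ℂ) * g n‖ ≤ 31 * A * D ^ 3 * P := by
    obtain ⟨hXk, hkY⟩ := mem_Icc.mp hk
    exact norm_sum_vonMangoldt_mul_le hX hXk (hkY.trans hY) hg hA hF
      (fun n hn ↦ hD n (hn.trans hkY)) (hI k hk) (hII k hk)
  have hlog : log Y ≤ D := (log_natCast_le_natLog_add_one le_rfl).trans
    (natLog_two_add_one_le_of_card_divisors_le (by lia) hD)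
  have hD1 : 1 ≤ D := (hD 1 (hX.trans hXY)).trans' (by simp)
  have hsqrt : √(Y : ℝ) ≤ 2 * P := (sqrt_natCast_le_of_le_three_mul hX hY).trans <| by
    rw [hP, add_assoc]
    gcongr
    exact le_add_of_nonneg_right (by positivity)
  have hlogA : log Y ≤ A * D ^ 3 := hlog.trans <| (le_self_pow₀ hD1 three_ne_zero).trans <|
    le_mul_of_one_le_left (by positivity) hA
  calc _ ≤ 4 * (31 * A * D ^ 3 * P + 2 * √Y * log Y) :=
        norm_sum_primes_le_of_norm_sum_vonMangoldt_mul_le hX hXY hg hΛ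
    _ ≤ 4 * (31 * A * D ^ 3 * P + 2 * (2 * P) * (A * D ^ 3)) := by gcongr
    _ = 140 * A * D ^ 3 * P := by ring

theorem exists_norm_sum_primes_phase_le {κ β γ η : ℝ} (hκ : 0 < κ) (hγ : γ ∈ Set.Ioo (11 / 12) 1)
    (hη : 0 < η) : ∃ C : ℝ, 0 < C ∧ ∀ (X Y : ℕ) (h θ : ℝ), 1 ≤ X → 4 * |β| ≤ γ * X → X ≤ Y →
      Y ≤ 3 * X → 1 ≤ h →
      ‖∑ p ∈ Ioc X Y with p.Prime, (𝐞 (phase (κ * h) β γ θ p) : ℂ)‖ ≤ C * (X : ℝ) ^ η *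
        ((X : ℝ) ^ (11 / 12 : ℝ) + (X : ℝ) ^ (2 / 3 : ℝ) * (h * (X : ℝ) ^ γ) ^ (1 / 4 : ℝ) +
          (X : ℝ) ^ (1 / 3 : ℝ) * (h * (X : ℝ) ^ γ) ^ (1 / 2 : ℝ)) := by
  have hγ' : γ ∈ Set.Ioo 0 1 := ⟨hγ.1.trans' (by norm_num), hγ.2⟩
  obtain ⟨A₁, hI⟩ := exists_typeIBound_phase (β := β) hκ hγ'
  obtain ⟨A₂, hII⟩ := exists_typeIIBound_phase (β := β) hκ hγ'
  obtain ⟨C₀, hC₀, hdiv⟩ := exists_card_divisors_le_of_le_three_mul (s := η / 3) (by linarith)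
  set A := max 1 (max A₁ A₂)
  refine ⟨140 * A * C₀ ^ 3, by positivity, fun X Y h θ hX hβ hXY hY hh ↦ ?_⟩
  have hX' : (1 : ℝ) ≤ X := mod_cast hX
  have hβ' : 2 * |β| ≤ X := by
    have : γ * X ≤ X := mul_le_of_le_one_left (by positivity) hγ.2.le
    linarith [abs_nonneg β]
  have hF : (X : ℝ) ^ (11 / 12 : ℝ) ≤ h * (X : ℝ) ^ γ :=
    (rpow_le_rpow_of_exponent_le hX' hγ.1.le).trans (le_mul_of_one_le_left (by positivity) hh)
  have hpow : (C₀ * (X : ℝ) ^ (η / 3)) ^ 3 = C₀ ^ 3 * (X : ℝ) ^ η := by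
    rw [mul_pow, ← rpow_mul_natCast (by positivity), Nat.cast_ofNat,
      div_mul_cancel₀ _ three_ne_zero]
  rw [mul_assoc (140 * A), ← hpow]
  refine norm_sum_primes_le_of_typeIBound_typeIIBound
    (g := fun n : ℕ ↦ (𝐞 (phase (κ * h) β γ θ n) : ℂ)) hX hXY hY
    (fun n ↦ (norm_fourierChar _).le) (le_max_left _ _) hF
    (fun n hn ↦ hdiv X n (hn.trans hY)) (fun k hk ↦ ?_) fun k hk ↦ ?_
  · refine (hI X k h θ hβ' ((mem_Icc.mp hk).2.trans hY) (by positivity)).mono ?_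
    gcongr
    exact (le_max_left _ _).trans (le_max_right _ _)
  · exact (hII X k h θ hβ ((mem_Icc.mp hk).2.trans hY) (by positivity)).mono
      ((le_max_right _ _).trans (le_max_right _ _))

end Primes

section Sawtooth

open Finset Real
open scoped FourierTransform

/-- The sawtooth function `{t} - 1 / 2`, which measures the error in replacing `⌊t⌋` by
`t - 1 / 2`. -/
noncomputable def sawtooth (t : ℝ) : ℝ := Int.fract t - 1 / 2

lemma hasSum_one_div_sq_mul_cos (t : ℝ) :
    HasSum (fun n : ℕ ↦ 1 / (n : ℝ) ^ 2 * cos (2 * π * n * t))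
      (π ^ 2 * bernoulliFun 2 (Int.fract t)) := by
  have h := hasSum_one_div_nat_pow_mul_cos one_ne_zero
    (x := Int.fract t) ⟨Int.fract_nonneg t, (Int.fract_lt_one t).le⟩
  rw [mul_one, ← bernoulliFun, Nat.factorial_two] at h
  convert! h using 1
  · ext n
    have : 2 * π * n * Int.fract t = 2 * π * n * t - (n * ⌊t⌋ : ℤ) * (2 * π) := by
      rw [Int.fract]
      push_cast
      ring
    rw [this, cos_sub_int_mul_two_pi]
  · push_cast
    ring

lemma bernoulliFun_two_fract_add_sub_le {t δ : ℝ} (hδ : δ ∈ Set.Ioo 0 1) :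
    bernoulliFun 2 (Int.fract (t + δ)) - bernoulliFun 2 (Int.fract t) ≤
      2 * δ * (sawtooth t + δ) := by
  obtain ⟨hδ₀, hδ₁⟩ := hδ
  have := Int.floor_add_fract t
  have := Int.fract_nonneg t
  have := Int.fract_lt_one t
  rcases lt_or_ge (Int.fract t + δ) 1 with h | h
  · have : Int.fract (t + δ) = Int.fract t + δ :=
      Int.fract_eq_iff.mpr ⟨by linarith, h, ⌊t⌋, by linarith⟩
    rw [bernoulliFun_two, bernoulliFun_two, sawtooth, this]
    nlinarith
  · have : Int.fract (t + δ) = Int.fract t + δ - 1 :=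
      Int.fract_eq_iff.mpr ⟨by linarith, by linarith, ⌊t⌋ + 1, by push_cast; linarith⟩
    rw [bernoulliFun_two, bernoulliFun_two, sawtooth, this]
    nlinarith

lemma bernoulliFun_two_fract_sub_sub_le {t δ : ℝ} (hδ : δ ∈ Set.Ioo 0 1) :
    bernoulliFun 2 (Int.fract (t + -δ)) - bernoulliFun 2 (Int.fract t) ≤
      2 * δ * (δ - sawtooth t) := by
  obtain ⟨hδ₀, hδ₁⟩ := hδ
  have := Int.floor_add_fract t
  have := Int.fract_nonneg t
  have := Int.fract_lt_one t
  rcases le_or_gt 0 (Int.fract t - δ) with h | h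
  · have : Int.fract (t + -δ) = Int.fract t - δ :=
      Int.fract_eq_iff.mpr ⟨h, by linarith, ⌊t⌋, by linarith⟩
    rw [bernoulliFun_two, bernoulliFun_two, sawtooth, this]
    nlinarith
  · have : Int.fract (t + -δ) = Int.fract t - δ + 1 :=
      Int.fract_eq_iff.mpr ⟨by linarith, by linarith, ⌊t⌋ - 1, by push_cast; linarith⟩
    rw [bernoulliFun_two, bernoulliFun_two, sawtooth, this]
    nlinarith

lemma norm_one_sub_fourierChar_mul_le {z η : ℝ} (hz : z ≠ 0) (hη : η ∈ Set.Icc 0 (1 / 2)) :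
    ‖1 - (𝐞 z : ℂ)‖ * (1 + √|z|) ≤ 4 * π * |z| ^ (1 - η) := by
  obtain ⟨hη₀, hη₁⟩ := hη
  have hz' : 0 < |z| := abs_pos.mpr hz
  rw [norm_one_sub_fourierChar]
  rcases le_total |z| 1 with h | h
  · have hsin : |sin (π * z)| ≤ π * |z| := by
      simpa only [abs_mul, abs_of_pos pi_pos] using abs_sin_le_abs (x := π * z)
    have hsqrt : √|z| ≤ 1 := sqrt_le_one.mpr h
    have hpow : |z| ≤ |z| ^ (1 - η) := by
      simpa only [rpow_one] using rpow_le_rpow_of_exponent_ge hz' h (by linarith : 1 - η ≤ 1)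
    calc 2 * |sin (π * z)| * (1 + √|z|) ≤ 2 * (π * |z|) * (1 + 1) := by gcongr
      _ = 4 * π * |z| := by ring
      _ ≤ 4 * π * |z| ^ (1 - η) := by gcongr
  · have hsqrt : √|z| ≤ |z| ^ (1 - η) := by
      rw [sqrt_eq_rpow]
      exact rpow_le_rpow_of_exponent_le h (by linarith)
    have hpow : 1 ≤ |z| ^ (1 - η) := one_le_rpow h (by linarith)
    calc 2 * |sin (π * z)| * (1 + √|z|) ≤ 2 * 1 * (|z| ^ (1 - η) + |z| ^ (1 - η)) := by
          gcongr
          exact abs_sin_le_one _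
      _ = 4 * 1 * |z| ^ (1 - η) := by ring
      _ ≤ 4 * π * |z| ^ (1 - η) := by
          gcongr
          linarith [pi_gt_three]

variable {ι : Type*} (s : Finset ι) (t : ι → ℝ)

lemma sum_cos_add_sub_cos (n z : ℝ) :
    ∑ i ∈ s, (cos (2 * π * n * (t i + z)) - cos (2 * π * n * t i)) =
      -((1 - (𝐞 (n * z) : ℂ)) * ∑ i ∈ s, (𝐞 (n * t i) : ℂ)).re := by
  have hcos (u : ℝ) : cos (2 * π * n * u) = (𝐞 (n * u) : ℂ).re := by
    rw [fourierChar_apply, Complex.exp_ofReal_mul_I_re, mul_assoc (2 * π)]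
  rw [mul_sum, Complex.re_sum, ← sum_neg_distrib]
  refine sum_congr rfl fun i _ ↦ ?_
  rw [hcos, hcos, mul_add, AddChar.map_add_eq_mul, Circle.coe_mul, ← Complex.sub_re,
    ← Complex.neg_re]
  ring_nf

lemma abs_sum_one_div_sq_mul_cos_sub_le {z V η : ℝ} {n : ℕ} (hn : n ≠ 0) (hz : z ≠ 0)
    (hη : η ∈ Set.Icc 0 (1 / 2))
    (hV : ‖∑ i ∈ s, (𝐞 (n * t i) : ℂ)‖ ≤ V * (1 + √(n * |z|))) :
    |∑ i ∈ s, (1 / (n : ℝ) ^ 2 * cos (2 * π * n * (t i + z)) -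
      1 / (n : ℝ) ^ 2 * cos (2 * π * n * t i))| ≤
      4 * π * V * |z| ^ (1 - η) * (n : ℝ) ^ (-(1 + η)) := by
  have hV₀ : 0 ≤ V := nonneg_of_mul_nonneg_left ((norm_nonneg _).trans hV) (by positivity)
  have hn₀ : (0 : ℝ) < n := mod_cast hn.pos
  have hnz : |n * z| = n * |z| := by rw [abs_mul, Nat.abs_cast]
  have hre : |((1 - (𝐞 (n * z) : ℂ)) * ∑ i ∈ s, (𝐞 (n * t i) : ℂ)).re| ≤
      4 * π * (n * |z|) ^ (1 - η) * V :=
    calc _ ≤ ‖1 - (𝐞 (n * z) : ℂ)‖ * (V * (1 + √|n * z|)) := by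
          refine (Complex.abs_re_le_norm _).trans ?_
          rw [norm_mul, hnz]
          gcongr
      _ = ‖1 - (𝐞 (n * z) : ℂ)‖ * (1 + √|n * z|) * V := by ring
      _ ≤ 4 * π * |n * z| ^ (1 - η) * V := by
          gcongr ?_ * V
          exact norm_one_sub_fourierChar_mul_le (mul_ne_zero hn₀.ne' hz) hη
      _ = 4 * π * (n * |z|) ^ (1 - η) * V := by rw [hnz]
  have hpow : (n : ℝ) ^ (-(1 + η)) = 1 / (n : ℝ) ^ 2 * (n : ℝ) ^ (1 - η) := by
    rw [one_div_mul_eq_div, ← rpow_two, ← rpow_sub hn₀]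
    congr 1
    ring
  simp only [← mul_sub]
  rw [← mul_sum, sum_cos_add_sub_cos, abs_mul, abs_neg, abs_of_nonneg (by positivity)]
  calc _ ≤ 1 / (n : ℝ) ^ 2 * (4 * π * (n * |z|) ^ (1 - η) * V) := by gcongr
    _ = 4 * π * V * |z| ^ (1 - η) * (n : ℝ) ^ (-(1 + η)) := by
        rw [hpow, mul_rpow hn₀.le (abs_nonneg z)]
        ring

lemma abs_sum_bernoulliFun_two_fract_sub_le {z V η : ℝ} (hz : z ≠ 0) (hη : η ∈ Set.Ioc 0 (1 / 2))
    (hV : ∀ n : ℕ, 1 ≤ n → ‖∑ i ∈ s, (𝐞 (n * t i) : ℂ)‖ ≤ V * (1 + √(n * |z|))) :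
    |∑ i ∈ s, (bernoulliFun 2 (Int.fract (t i + z)) - bernoulliFun 2 (Int.fract (t i)))| ≤
      2 * |z| * ((∑' n : ℕ, (n : ℝ) ^ (-(1 + η))) * V * |z| ^ (-η)) := by
  have hV₀ : 0 ≤ V :=
    nonneg_of_mul_nonneg_left ((norm_nonneg _).trans (hV 1 le_rfl)) (by positivity)
  have hη₀ := hη.1
  have hsum : HasSum (fun n : ℕ ↦ ∑ i ∈ s, (1 / (n : ℝ) ^ 2 * cos (2 * π * n * (t i + z))
      - 1 / (n : ℝ) ^ 2 * cos (2 * π * n * t i)))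
      (∑ i ∈ s, (π ^ 2 * bernoulliFun 2 (Int.fract (t i + z)) -
        π ^ 2 * bernoulliFun 2 (Int.fract (t i)))) :=
    hasSum_sum fun i _ ↦ (hasSum_one_div_sq_mul_cos _).sub (hasSum_one_div_sq_mul_cos _)
  have hsummable : Summable fun n : ℕ ↦ (n : ℝ) ^ (-(1 + η)) :=
    summable_nat_rpow.mpr (by linarith)
  have hbound := hsum.norm_le_of_bounded
    (hsummable.mul_left (4 * π * V * |z| ^ (1 - η))).hasSum fun n ↦ by
      rcases eq_or_ne n 0 with rfl | hn
      · simp only [Nat.cast_zero, zero_pow two_ne_zero, div_zero, zero_mul, sub_self,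
          sum_const_zero, norm_zero]
        positivity
      · exact abs_sum_one_div_sq_mul_cos_sub_le s t hn hz ⟨hη₀.le, hη.2⟩ (hV n hn.pos)
  simp only [tsum_mul_left, norm_eq_abs, ← mul_sub, ← mul_sum, abs_mul,
    abs_of_pos (pow_pos pi_pos 2)] at hbound
  set Z := ∑' n : ℕ, (n : ℝ) ^ (-(1 + η))
  have : 0 ≤ Z := tsum_nonneg fun n ↦ by positivity
  refine le_of_mul_le_mul_left (hbound.trans ?_) (pow_pos pi_pos 2)
  calc 4 * π * V * |z| ^ (1 - η) * Z = 2 * 2 * π * (Z * V * (|z| * |z| ^ (-η))) := by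
        rw [sub_eq_add_neg, rpow_add (abs_pos.mpr hz), rpow_one]
        ring
    _ ≤ 2 * π * π * (Z * V * (|z| * |z| ^ (-η))) := by
        gcongr ?_ * _
        nlinarith [pi_gt_three]
    _ = π ^ 2 * (2 * |z| * (Z * V * |z| ^ (-η))) := by ring

/-- A sum of `sawtooth` is controlled by exponential sums: by convexity the sawtooth lies between
difference quotients of the periodic `bernoulliFun 2`, whose Fourier series converges absolutely. -/
theorem abs_sum_sawtooth_le {δ V η : ℝ} (hδ : δ ∈ Set.Ioo 0 1) (hη : η ∈ Set.Ioc 0 (1 / 2))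
    (hV : ∀ n : ℕ, 1 ≤ n → ‖∑ i ∈ s, (𝐞 (n * t i) : ℂ)‖ ≤ V * (1 + √(n * δ))) :
    |∑ i ∈ s, sawtooth (t i)| ≤
      #s * δ + (∑' n : ℕ, (n : ℝ) ^ (-(1 + η))) * V * δ ^ (-η) := by
  have hδ₀ : 0 < δ := hδ.1
  have hplus := abs_sum_bernoulliFun_two_fract_sub_le s t hδ₀.ne' hη
    (by simpa only [abs_of_pos hδ₀] using hV)
  have hminus := abs_sum_bernoulliFun_two_fract_sub_le s t (neg_ne_zero.mpr hδ₀.ne') hη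
    (by simpa only [abs_neg, abs_of_pos hδ₀] using hV)
  rw [abs_neg] at hminus
  rw [abs_of_pos hδ₀] at hplus hminus
  have hlower := sum_le_sum fun i (_ : i ∈ s) ↦ bernoulliFun_two_fract_add_sub_le (t := t i) hδ
  have hupper := sum_le_sum fun i (_ : i ∈ s) ↦ bernoulliFun_two_fract_sub_sub_le (t := t i) hδ
  rw [← mul_sum, sum_add_distrib, sum_const, nsmul_eq_mul] at hlower
  rw [← mul_sum, sum_sub_distrib (f := fun _ ↦ δ), sum_const, nsmul_eq_mul] at hupper
  rw [abs_le]
  constructor <;> refine le_of_mul_le_mul_left ?_ (by positivity : 0 < 2 * δ)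
  · linarith [(abs_le.mp hplus).1]
  · linarith [(abs_le.mp hminus).1]

end Sawtooth

section Progressions

open Finset Real
open scoped FourierTransform

lemma stdAddChar_mul_natCast {q : ℕ} [NeZero q] (k : ZMod q) (n : ℕ) :
    ZMod.stdAddChar (k * (n : ZMod q)) = (𝐞 (k.val / q * n : ℝ) : ℂ) := by
  have : k * (n : ZMod q) = ((k.val * n : ℤ) : ZMod q) := by
    push_cast
    rw [ZMod.natCast_zmod_val]
  rw [this, ZMod.stdAddChar_coe, fourierChar_apply]
  congr 1
  push_cast
  ring

lemma norm_sum_modEq_le {s : Finset ℕ} {c : ℕ → ℂ} {q : ℕ} [NeZero q] {B : ℝ} (a : ℤ)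
    (hB : ∀ θ : ℝ, ‖∑ n ∈ s, c n * (𝐞 (θ * n) : ℂ)‖ ≤ B) :
    ‖∑ n ∈ s with ((n : ℕ) : ℤ) ≡ a [ZMOD q], c n‖ ≤ B := by
  have horth : (q : ℂ) * ∑ n ∈ s with ((n : ℕ) : ℤ) ≡ a [ZMOD q], c n =
      ∑ k : ZMod q, ZMod.stdAddChar (-(k * (a : ZMod q))) *
        ∑ n ∈ s, c n * (𝐞 (k.val / q * n : ℝ) : ℂ) := by
    simp only [mul_sum]
    rw [sum_comm, sum_filter]
    refine sum_congr rfl fun n _ ↦ ?_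
    have hmod : (n : ℤ) ≡ a [ZMOD q] ↔ (n : ZMod q) - (a : ZMod q) = 0 := by
      rw [sub_eq_zero, ← ZMod.intCast_eq_intCast_iff, Int.cast_natCast]
    have hterm (k : ZMod q) :
        ZMod.stdAddChar (-(k * (a : ZMod q))) * (c n * (𝐞 (k.val / q * n : ℝ) : ℂ)) =
          c n * ZMod.stdAddChar (k * ((n : ZMod q) - (a : ZMod q))) := by
      rw [← stdAddChar_mul_natCast, mul_sub, sub_eq_neg_add, AddChar.map_add_eq_mul]
      ring
    simp only [hterm, ← mul_sum, AddChar.sum_mulShift _ (ZMod.isPrimitive_stdAddChar q), hmod,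
      ZMod.card]
    split_ifs
    · rw [mul_comm]
    · rw [Nat.cast_zero, mul_zero]
  have hq : (0 : ℝ) < q := mod_cast NeZero.pos q
  refine le_of_mul_le_mul_left ?_ hq
  calc q * ‖∑ n ∈ s with ((n : ℕ) : ℤ) ≡ a [ZMOD q], c n‖
      = ‖∑ k : ZMod q, ZMod.stdAddChar (-(k * (a : ZMod q))) *
          ∑ n ∈ s, c n * (𝐞 (k.val / q * n : ℝ) : ℂ)‖ := by
        rw [← horth, norm_mul, Complex.norm_natCast]
    _ ≤ ∑ _k : ZMod q, B := norm_sum_le_of_le _ fun k _ ↦ by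
        rw [norm_mul, ZMod.stdAddChar_apply, Circle.norm_coe, one_mul]
        exact hB _
    _ = q * B := by rw [sum_const, card_univ, ZMod.card, nsmul_eq_mul]

end Progressions

section SawtoothOfPrimes

open Finset Real
open scoped FourierTransform

lemma rpow_le_one_add_sqrt {y s : ℝ} (hy : 0 ≤ y) (hs : s ∈ Set.Icc 0 (1 / 2)) :
    y ^ s ≤ 1 + √y := by
  rcases le_total y 1 with h | h
  · linarith [rpow_le_one hy h hs.1, sqrt_nonneg y]
  · have : y ^ s ≤ √y := by
      rw [sqrt_eq_rpow]
      exact rpow_le_rpow_of_exponent_le h hs.2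
    linarith

lemma rpow_mul_mul_rpow_le {x h γ E e s : ℝ} (hx : 1 ≤ x) (hh : 0 ≤ h)
    (hs : s ∈ Set.Icc 0 (1 / 2)) (hE : e + γ * s + (1 - E) * s ≤ E) :
    x ^ e * (h * x ^ γ) ^ s ≤ x ^ E * (1 + √(h * x ^ (E - 1))) := by
  have hx₀ : 0 < x := one_pos.trans_le hx
  calc x ^ e * (h * x ^ γ) ^ s = h ^ s * x ^ (e + γ * s) := by
        rw [mul_rpow hh (by positivity), ← rpow_mul hx₀.le, rpow_add hx₀]
        ring
    _ ≤ h ^ s * x ^ (E + (E - 1) * s) := by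
        gcongr h ^ s * ?_
        exact rpow_le_rpow_of_exponent_le hx (by linarith)
    _ = x ^ E * (h * x ^ (E - 1)) ^ s := by
        rw [mul_rpow hh (by positivity), ← rpow_mul hx₀.le, rpow_add hx₀]
        ring
    _ ≤ x ^ E * (1 + √(h * x ^ (E - 1))) := by
        gcongr
        exact rpow_le_one_add_sqrt (by positivity) hs

-- The exponent `E = γ / 5 + 11 / 15` solves `2 / 3 + γ / 4 + (1 - E) / 4 = E`, which makes the
-- dominant term `x ^ (2 / 3) * (h * x ^ γ) ^ (1 / 4)` equal to `x ^ E` at `h = x ^ (1 - E)`.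
lemma rpow_add_rpow_mul_add_rpow_mul_le {γ E x h : ℝ} (hγ : γ ∈ Set.Ioo (11 / 12) 1)
    (hE : E = γ / 5 + 11 / 15) (hx : 1 ≤ x) (hh : 0 ≤ h) :
    x ^ (11 / 12 : ℝ) + x ^ (2 / 3 : ℝ) * (h * x ^ γ) ^ (1 / 4 : ℝ) +
      x ^ (1 / 3 : ℝ) * (h * x ^ γ) ^ (1 / 2 : ℝ) ≤ 3 * (x ^ E * (1 + √(h * x ^ (E - 1)))) := by
  obtain ⟨hγ₀, hγ₁⟩ := hγ
  have h₀ := rpow_mul_mul_rpow_le (γ := γ) (E := E) (e := 11 / 12) (s := 0) hx hh (by norm_num)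
    (by linarith)
  rw [rpow_zero, mul_one] at h₀
  have h₁ := rpow_mul_mul_rpow_le (γ := γ) (E := E) (e := 2 / 3) (s := 1 / 4) hx hh (by norm_num)
    (by linarith)
  have h₂ := rpow_mul_mul_rpow_le (γ := γ) (E := E) (e := 1 / 3) (s := 1 / 2) hx hh (by norm_num)
    (by linarith)
  linarith

lemma exists_norm_sum_primes_modEq_le {κ β γ η E : ℝ} (hκ : 0 < κ)
    (hγ : γ ∈ Set.Ioo (11 / 12) 1) (hE : E = γ / 5 + 11 / 15) (hη : 0 < η) :
    ∃ C : ℝ, 0 < C ∧ ∀ (X Y h q : ℕ) (a : ℤ) [NeZero q], 1 ≤ X → 4 * |β| ≤ γ * X → X ≤ Y →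
      Y ≤ 3 * X → 1 ≤ h →
      ‖∑ p ∈ Ioc X Y with p.Prime ∧ ((p : ℕ) : ℤ) ≡ a [ZMOD q],
        (𝐞 (h * (-(κ * (p - β) ^ γ))) : ℂ)‖ ≤
      C * (X : ℝ) ^ (E + η) * (1 + √(h * (X : ℝ) ^ (E - 1))) := by
  obtain ⟨C, hC, hphase⟩ := exists_norm_sum_primes_phase_le (β := β) hκ hγ hη
  refine ⟨3 * C, by positivity, fun X Y h q a _ hX hβ hXY hY hh ↦ ?_⟩
  rw [← filter_filter]
  refine norm_sum_modEq_le a fun θ ↦ ?_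
  have hchar (p : ℕ) : (𝐞 (h * (-(κ * (p - β) ^ γ))) : ℂ) * (𝐞 (θ * p) : ℂ) =
      𝐞 (phase (κ * h) β γ θ p) := by
    rw [← Circle.coe_mul, ← AddChar.map_add_eq_mul, phase]
    ring_nf
  simp only [hchar]
  calc _ ≤ C * (X : ℝ) ^ η * ((X : ℝ) ^ (11 / 12 : ℝ) +
          (X : ℝ) ^ (2 / 3 : ℝ) * (h * (X : ℝ) ^ γ) ^ (1 / 4 : ℝ) +
          (X : ℝ) ^ (1 / 3 : ℝ) * (h * (X : ℝ) ^ γ) ^ (1 / 2 : ℝ)) :=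
        hphase X Y h θ hX hβ hXY hY (mod_cast hh)
    _ ≤ C * (X : ℝ) ^ η * (3 * ((X : ℝ) ^ E * (1 + √(h * (X : ℝ) ^ (E - 1))))) := by
        gcongr
        exact rpow_add_rpow_mul_add_rpow_mul_le hγ hE (mod_cast hX) h.cast_nonneg
    _ = 3 * C * (X : ℝ) ^ (E + η) * (1 + √(h * (X : ℝ) ^ (E - 1))) := by
        rw [rpow_add (mod_cast hX)]
        ring

theorem exists_abs_sum_sawtooth_block_le {κ β γ E : ℝ} (hκ : 0 < κ)
    (hγ : γ ∈ Set.Ioo (11 / 12) 1) (hE : γ / 5 + 11 / 15 < E) :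
    ∃ C : ℝ, 0 < C ∧ ∀ (X Y q : ℕ) (a : ℤ) [NeZero q], 2 ≤ X → 4 * |β| ≤ γ * X → X ≤ Y →
      Y ≤ 3 * X →
      |∑ p ∈ Ioc X Y with p.Prime ∧ ((p : ℕ) : ℤ) ≡ a [ZMOD q], sawtooth (-(κ * (p - β) ^ γ))| ≤
        C * (X : ℝ) ^ E := by
  obtain ⟨E₀, hE₀⟩ : ∃ E₀, E₀ = γ / 5 + 11 / 15 := ⟨_, rfl⟩
  obtain ⟨hγ₀, hγ₁⟩ := hγ
  set η := min ((E - E₀) / 2) (1 / 2)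
  have hη : η ∈ Set.Ioc 0 (1 / 2) := ⟨lt_min (by linarith) (by norm_num), min_le_right _ _⟩
  have hηE : η ≤ (E - E₀) / 2 := min_le_left _ _
  obtain ⟨C, hC, hexp⟩ := exists_norm_sum_primes_modEq_le (β := β) hκ ⟨hγ₀, hγ₁⟩ hE₀ hη.1
  set Z := ∑' n : ℕ, (n : ℝ) ^ (-(1 + η))
  have : 0 ≤ Z := tsum_nonneg fun n ↦ by positivity
  refine ⟨2 + Z * C, by positivity, fun X Y q a _ hX hβ hXY hY ↦ ?_⟩
  have hX₁ : (1 : ℝ) < X := mod_cast hX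
  have hX₀ : (0 : ℝ) < X := one_pos.trans hX₁
  set δ := (X : ℝ) ^ (E₀ - 1)
  have hδ : δ ∈ Set.Ioo 0 1 :=
    ⟨by positivity, rpow_lt_one_of_one_lt_of_neg hX₁ (by linarith)⟩
  have hcard : (#{p ∈ Ioc X Y | p.Prime ∧ ((p : ℕ) : ℤ) ≡ a [ZMOD q]} : ℝ) ≤ 2 * X :=
    mod_cast (card_filter_le _ _).trans (by rw [Nat.card_Ioc]; lia)
  have hmain : X * δ ≤ (X : ℝ) ^ E := by
    rw [← rpow_one_add' hX₀.le (by linarith)]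
    exact rpow_le_rpow_of_exponent_le hX₁.le (by linarith)
  have htail : (X : ℝ) ^ (E₀ + η) * δ ^ (-η) ≤ (X : ℝ) ^ E := by
    rw [← rpow_mul hX₀.le, ← rpow_add hX₀]
    exact rpow_le_rpow_of_exponent_le hX₁.le (by nlinarith [hη.1])
  calc _ ≤ _ * δ + Z * (C * (X : ℝ) ^ (E₀ + η)) * δ ^ (-η) :=
        abs_sum_sawtooth_le _ _ hδ hη fun h hh ↦ hexp X Y h q a (by lia) hβ hXY hY hh
    _ ≤ 2 * X * δ + Z * (C * (X : ℝ) ^ (E₀ + η)) * δ ^ (-η) := by gcongr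
    _ = 2 * (X * δ) + Z * C * ((X : ℝ) ^ (E₀ + η) * δ ^ (-η)) := by ring
    _ ≤ 2 * (X : ℝ) ^ E + Z * C * (X : ℝ) ^ E := by gcongr
    _ = (2 + Z * C) * (X : ℝ) ^ E := by ring

lemma abs_sum_Ioc_le_of_dyadic {f : ℕ → ℝ} {N₀ : ℕ} {C E : ℝ} (hN₀ : 1 ≤ N₀) (hE : 1 / 2 ≤ E)
    (hC : 0 ≤ C)
    (hf : ∀ X Y, N₀ ≤ X → X ≤ Y → Y ≤ 3 * X → |∑ n ∈ Ioc X Y, f n| ≤ C * (X : ℝ) ^ E) (N : ℕ) :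
    |∑ n ∈ Ioc N₀ N, f n| ≤ 4 * C * (N : ℝ) ^ E := by
  induction N using Nat.strong_induction_on with
  | _ N ih =>
    rcases le_or_gt N N₀ with hN | hN
    · rw [Ioc_eq_empty_of_le hN, sum_empty, abs_zero]
      positivity
    rcases lt_or_ge N (2 * N₀) with hN₂ | hN₂
    · calc _ ≤ C * (N₀ : ℝ) ^ E := hf N₀ N le_rfl hN.le (by lia)
        _ ≤ C * (N : ℝ) ^ E := by gcongr
        _ ≤ 4 * C * (N : ℝ) ^ E := by
            gcongr
            linarith
    have hhalf : ((N / 2 : ℕ) : ℝ) ^ E ≤ 4 / 5 * (N : ℝ) ^ E := by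
      have htwo : 5 / 4 ≤ (2 : ℝ) ^ E :=
        calc (5 / 4 : ℝ) ≤ √2 := le_sqrt_of_sq_le (by norm_num)
          _ = 2 ^ (1 / 2 : ℝ) := sqrt_eq_rpow 2
          _ ≤ 2 ^ E := rpow_le_rpow_of_exponent_le one_le_two hE
      calc ((N / 2 : ℕ) : ℝ) ^ E ≤ (N / 2 : ℝ) ^ E := by
            gcongr
            exact Nat.cast_div_le
        _ = (N : ℝ) ^ E / 2 ^ E := div_rpow N.cast_nonneg two_pos.le E
        _ ≤ (N : ℝ) ^ E / (5 / 4) := by gcongr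
        _ = 4 / 5 * (N : ℝ) ^ E := by ring
    rw [← sum_Ioc_consecutive f (by lia : N₀ ≤ N / 2) (by lia)]
    calc _ ≤ 4 * C * ((N / 2 : ℕ) : ℝ) ^ E + C * ((N / 2 : ℕ) : ℝ) ^ E :=
          (abs_add_le _ _).trans
            (add_le_add (ih _ (by lia)) (hf _ _ (by lia) (by lia) (by lia)))
      _ = 5 * C * ((N / 2 : ℕ) : ℝ) ^ E := by ring
      _ ≤ 5 * C * (4 / 5 * (N : ℝ) ^ E) := by gcongr
      _ = 4 * C * (N : ℝ) ^ E := by ring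

theorem exists_abs_sum_sawtooth_primes_le {κ β γ E : ℝ} (hκ : 0 < κ)
    (hγ : γ ∈ Set.Ioo (11 / 12) 1) (hE : γ / 5 + 11 / 15 < E) :
    ∃ (N₁ : ℕ) (C : ℝ), ∀ (N₀ N q : ℕ) (a : ℤ) [NeZero q], N₁ ≤ N₀ →
      |∑ p ∈ Ioc N₀ N with p.Prime ∧ ((p : ℕ) : ℤ) ≡ a [ZMOD q], sawtooth (-(κ * (p - β) ^ γ))| ≤
        C * (N : ℝ) ^ E := by
  have hγ₀ : 0 < γ := hγ.1.trans' (by norm_num)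
  obtain ⟨C, hC, hblock⟩ := exists_abs_sum_sawtooth_block_le (β := β) hκ hγ hE
  refine ⟨max 2 ⌈4 * |β| / γ⌉₊, 4 * C, fun N₀ N q a _ hN₀ ↦ ?_⟩
  obtain ⟨hN₀', hβ⟩ := max_le_iff.mp hN₀
  rw [sum_filter]
  refine abs_sum_Ioc_le_of_dyadic (by lia) (by linarith) hC.le (fun X Y hX hXY hY ↦ ?_) N
  rw [← sum_filter]
  refine hblock X Y q a (by lia) ?_ hXY hY
  rw [← div_le_iff₀' hγ₀]
  exact Nat.ceil_le.mp (hβ.trans hX)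

end SawtoothOfPrimes

section Indicator

open Finset Real Filter

lemma mem_genPiatetskiShapiro_iff {α β c : ℝ} {n : ℕ} (hα : 0 < α) (hc : 0 < c)
    (hn : 0 < (n : ℝ) - β) :
    (n : ℤ) ∈ genPiatetskiShapiro α β c ↔ ∃ m : ℤ, α ^ (-c⁻¹) * (n - β) ^ c⁻¹ ≤ m ∧
      m < α ^ (-c⁻¹) * (n - β + 1) ^ c⁻¹ := by
  have hscale {u : ℝ} (hu : 0 < u) : α ^ (-c⁻¹) * u ^ c⁻¹ = (u / α) ^ c⁻¹ := by
    rw [div_rpow hu.le hα.le, rpow_neg hα.le]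
    ring
  have hn₁ : 0 < (n : ℝ) - β + 1 := by linarith
  rw [hscale hn, hscale hn₁]
  have hfloor (m : ℕ) : (n : ℤ) = ⌊α * (m : ℝ) ^ c + β⌋ ↔
      ((n - β) / α) ^ c⁻¹ ≤ m ∧ m < ((n - β + 1) / α) ^ c⁻¹ := by
    rw [rpow_inv_le_iff_of_pos (by positivity) m.cast_nonneg hc,
      lt_rpow_inv_iff_of_pos m.cast_nonneg (by positivity) hc, div_le_iff₀' hα,
      lt_div_iff₀' hα, eq_comm, Int.floor_eq_iff]
    push_cast
    constructor <;> rintro ⟨hle, hlt⟩ <;> constructor <;> linarith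
  constructor
  · rintro ⟨m, -, hm⟩
    exact ⟨m, mod_cast (hfloor m).mp hm⟩
  · rintro ⟨m, hle, hlt⟩
    have hm : 0 < m := mod_cast (by positivity : 0 < ((n - β) / α) ^ c⁻¹).trans_le hle
    lift m to ℕ using hm.le
    exact ⟨m, by lia, (hfloor m).mpr (mod_cast And.intro hle hlt)⟩

lemma ceil_eq_add_sawtooth (t : ℝ) : (⌈t⌉ : ℝ) = t + sawtooth (-t) + 1 / 2 := by
  rw [sawtooth, Int.fract, Int.floor_neg]
  push_cast
  ring

open Classical in
lemma ite_exists_int_mem_Ico_eq {A B : ℝ} (hAB : B - A ∈ Set.Icc 0 1) :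
    (if ∃ m : ℤ, A ≤ m ∧ m < B then 1 else 0) = B - A + sawtooth (-B) - sawtooth (-A) := by
  have hceil : B - A + sawtooth (-B) - sawtooth (-A) = ((⌈B⌉ - ⌈A⌉ : ℤ) : ℝ) := by
    push_cast
    rw [ceil_eq_add_sawtooth, ceil_eq_add_sawtooth]
    ring
  have hle : ⌈A⌉ ≤ ⌈B⌉ := Int.ceil_le_ceil (by linarith [hAB.1])
  have hle_add_one : ⌈B⌉ ≤ ⌈A⌉ + 1 := by
    rw [← Int.ceil_add_one]
    exact Int.ceil_le_ceil (by linarith [hAB.2])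
  have hiff : (∃ m : ℤ, A ≤ m ∧ m < B) ↔ ⌈A⌉ < ⌈B⌉ := by
    simp only [← Int.ceil_le, ← Int.lt_ceil]
    exact ⟨fun ⟨_, hm⟩ ↦ hm.1.trans_lt hm.2, fun h ↦ ⟨_, le_rfl, h⟩⟩
  rw [hceil]
  split_ifs with h <;> rw [hiff] at h
  · rw [(by lia : ⌈B⌉ - ⌈A⌉ = 1), Int.cast_one]
  · rw [(by lia : ⌈B⌉ - ⌈A⌉ = 0), Int.cast_zero]

lemma exists_rpow_add_one_sub_rpow_eq (γ : ℝ) {u : ℝ} (hu : 0 < u) :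
    ∃ v ∈ Set.Ioo u (u + 1), (u + 1) ^ γ - u ^ γ = γ * v ^ (γ - 1) := by
  have hderiv {v : ℝ} (hv : u ≤ v) : HasDerivAt (· ^ γ) (γ * v ^ (γ - 1)) v :=
    hasDerivAt_rpow_const (Or.inl (hu.trans_le hv).ne')
  obtain ⟨v, hv, hslope⟩ := exists_hasDerivAt_eq_slope (· ^ γ) (fun v ↦ γ * v ^ (γ - 1))
    (lt_add_one u) (fun v hv ↦ (hderiv hv.1).continuousAt.continuousWithinAt)
    (fun v hv ↦ hderiv hv.1.le)
  rw [add_sub_cancel_left, div_one] at hslope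
  exact ⟨v, hv, hslope.symm⟩

lemma abs_rpow_sub_rpow_le {s x y : ℝ} (hs : s ∈ Set.Icc (-1) 0) (hx : 0 < x) (hy : x / 2 ≤ y) :
    |y ^ s - x ^ s| ≤ 4 * x ^ (s - 1) * |y - x| := by
  have hderiv (w : ℝ) (hw : w ∈ Set.Ici (x / 2)) :
      HasDerivWithinAt (· ^ s) (s * w ^ (s - 1)) (Set.Ici (x / 2)) w :=
    (hasDerivAt_rpow_const (Or.inl ((half_pos hx).trans_le hw).ne')).hasDerivWithinAt
  refine (convex_Ici (x / 2)).norm_image_sub_le_of_norm_hasDerivWithin_le hderiv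
    (fun w hw ↦ ?_) (half_le_self hx.le) hy
  have hw₀ : 0 < w := (half_pos hx).trans_le hw
  calc ‖s * w ^ (s - 1)‖ = |s| * w ^ (s - 1) := by
        rw [norm_mul, norm_eq_abs, norm_of_nonneg (by positivity)]
    _ ≤ 1 * (x / 2) ^ (s - 1) :=
        mul_le_mul (abs_le.mpr ⟨hs.1, hs.2.trans zero_le_one⟩)
          (rpow_le_rpow_of_nonpos (by positivity) hw (by linarith [hs.2])) (by positivity)
          zero_le_one
    _ = 2 ^ (1 - s) * x ^ (s - 1) := by
        rw [div_rpow hx.le two_pos.le, ← neg_sub s 1, rpow_neg two_pos.le]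
        ring
    _ ≤ 2 ^ (2 : ℝ) * x ^ (s - 1) := by
        gcongr
        · exact one_le_two
        · linarith [hs.1]
    _ = 4 * x ^ (s - 1) := by norm_num

lemma abs_rpow_add_one_sub_rpow_sub_le {β γ x : ℝ} (hγ : γ ∈ Set.Ioo 0 1)
    (hx : 2 * |β| + 2 ≤ x) :
    |(x - β + 1) ^ γ - (x - β) ^ γ - γ * x ^ (γ - 1)| ≤ γ * (4 * (1 + |β|)) * x ^ (γ - 2) := by
  have := neg_abs_le β
  have := le_abs_self β
  obtain ⟨v, hv, hincr⟩ := exists_rpow_add_one_sub_rpow_eq γ (by linarith : 0 < x - β)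
  have hvx : |v - x| ≤ 1 + |β| := abs_le.mpr ⟨by linarith [hv.1], by linarith [hv.2]⟩
  have hx₀ : 0 < x := by linarith
  calc |(x - β + 1) ^ γ - (x - β) ^ γ - γ * x ^ (γ - 1)| = γ * |v ^ (γ - 1) - x ^ (γ - 1)| := by
        rw [hincr, ← mul_sub, abs_mul, abs_of_pos hγ.1]
    _ ≤ γ * (4 * x ^ (γ - 1 - 1) * |v - x|) := by
        gcongr
        · exact hγ.1.le
        · exact abs_rpow_sub_rpow_le ⟨by linarith [hγ.1], by linarith [hγ.2]⟩ hx₀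
            (by linarith [hv.1])
    _ ≤ γ * (4 * x ^ (γ - 1 - 1) * (1 + |β|)) := by
        gcongr
        exact hγ.1.le
    _ = γ * (4 * (1 + |β|)) * x ^ (γ - 2) := by
        rw [sub_sub, one_add_one_eq_two]
        ring

lemma abs_sum_rpow_add_one_sub_rpow_sub_le {s : Finset ℕ} {β γ : ℝ} (hγ : γ ∈ Set.Ioo 0 1)
    (hs : ∀ n ∈ s, 2 * |β| + 2 ≤ n) :
    |∑ n ∈ s, ((n - β + 1) ^ γ - (n - β) ^ γ - γ * (n : ℝ) ^ (γ - 1))| ≤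
      γ * (4 * (1 + |β|)) * ∑' n : ℕ, (n : ℝ) ^ (γ - 2) := by
  have hsummable : Summable fun n : ℕ ↦ (n : ℝ) ^ (γ - 2) :=
    summable_nat_rpow.mpr (by linarith [hγ.2])
  have := hγ.1
  calc _ ≤ ∑ n ∈ s, γ * (4 * (1 + |β|)) * (n : ℝ) ^ (γ - 2) :=
        abs_sum_le_sum_abs _ _ |>.trans <|
          sum_le_sum fun n hn ↦ abs_rpow_add_one_sub_rpow_sub_le hγ (hs n hn)
    _ = γ * (4 * (1 + |β|)) * ∑ n ∈ s, (n : ℝ) ^ (γ - 2) := by rw [mul_sum]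
    _ ≤ γ * (4 * (1 + |β|)) * ∑' n : ℕ, (n : ℝ) ^ (γ - 2) := by
        gcongr
        exact hsummable.sum_le_tsum s fun n _ ↦ by positivity

lemma eventually_mul_rpow_add_one_sub_rpow_mem_Icc {κ γ : ℝ} (hκ : 0 ≤ κ)
    (hγ : γ ∈ Set.Ioo 0 1) :
    ∀ᶠ u : ℝ in atTop, κ * (u + 1) ^ γ - κ * u ^ γ ∈ Set.Icc 0 1 := by
  have htendsto : Tendsto (fun u : ℝ ↦ κ * γ * u ^ (γ - 1)) atTop (nhds (κ * γ * 0)) := by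
    rw [← neg_sub 1 γ]
    exact (tendsto_rpow_neg_atTop (sub_pos.mpr hγ.2)).const_mul _
  rw [mul_zero] at htendsto
  filter_upwards [htendsto.eventually_le_const one_pos, eventually_gt_atTop 0] with u hle hu
  obtain ⟨v, hv, hincr⟩ := exists_rpow_add_one_sub_rpow_eq γ hu
  have hv₀ : 0 < v := hu.trans hv.1
  have := hγ.1
  rw [← mul_sub, hincr, ← mul_assoc]
  refine ⟨by positivity, hle.trans' ?_⟩
  gcongr κ * γ * ?_
  exact rpow_le_rpow_of_nonpos hu hv.1.le (by linarith [hγ.2])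

/-- The indicator of the Piatetski-Shapiro sequence at `n`, minus its expected value, the density
`α ^ (-γ) * γ * n ^ (γ - 1)` with `γ = 1 / c`. -/
noncomputable def excess (α β c : ℝ) (n : ℕ) : ℝ :=
  (genPiatetskiShapiro α β c).indicator 1 (n : ℤ) - α ^ (-c⁻¹) * c⁻¹ * (n : ℝ) ^ (c⁻¹ - 1)

lemma eventually_excess_eq {α c : ℝ} (β : ℝ) (hα : 0 < α) (hc : 1 < c) :
    ∀ᶠ n : ℕ in atTop, excess α β c n =
      α ^ (-c⁻¹) * ((n - β + 1) ^ c⁻¹ - (n - β) ^ c⁻¹ - c⁻¹ * (n : ℝ) ^ (c⁻¹ - 1)) +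
        sawtooth (-(α ^ (-c⁻¹) * (n - (β - 1)) ^ c⁻¹)) -
        sawtooth (-(α ^ (-c⁻¹) * (n - β) ^ c⁻¹)) := by
  have hc₀ : 0 < c := one_pos.trans hc
  have htendsto : Tendsto (fun n : ℕ ↦ (n : ℝ) - β) atTop atTop :=
    tendsto_atTop_add_const_right _ (-β) tendsto_natCast_atTop_atTop
  have hincr := htendsto.eventually (eventually_mul_rpow_add_one_sub_rpow_mem_Icc
    (rpow_nonneg hα.le (-c⁻¹)) ⟨inv_pos.mpr hc₀, inv_lt_one_of_one_lt₀ hc⟩)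
  filter_upwards [hincr, htendsto.eventually_gt_atTop 0] with n hn hpos
  classical
  rw [excess, Set.indicator_apply, Pi.one_apply]
  simp only [mem_genPiatetskiShapiro_iff hα hc₀ hpos]
  rw [ite_exists_int_mem_Ico_eq hn, ← sub_add (n : ℝ) β 1]
  ring

theorem exists_abs_sum_Ioc_excess_primes_le {α β c E : ℝ} (hα : 0 < α)
    (hc : c ∈ Set.Ioo 1 (12 / 11)) (hE : c⁻¹ / 5 + 11 / 15 < E) :
    ∃ (N₀ : ℕ) (C : ℝ), ∀ (N q : ℕ) (a : ℤ) [NeZero q], 1 ≤ N →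
      |∑ p ∈ Ioc N₀ N with p.Prime ∧ ((p : ℕ) : ℤ) ≡ a [ZMOD q], excess α β c p| ≤
        C * (N : ℝ) ^ E := by
  have hc₀ : 0 < c := one_pos.trans hc.1
  have hγ : c⁻¹ ∈ Set.Ioo (11 / 12) 1 :=
    ⟨by rw [lt_inv_comm₀ (by norm_num) hc₀, inv_div]; exact hc.2, inv_lt_one_of_one_lt₀ hc.1⟩
  have hγ₀ : 0 < c⁻¹ := inv_pos.mpr hc₀
  have hκ : 0 < α ^ (-c⁻¹) := by positivity
  obtain ⟨N₁, C₁, h₁⟩ := exists_abs_sum_sawtooth_primes_le (β := β - 1) hκ hγ hE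
  obtain ⟨N₂, C₂, h₂⟩ := exists_abs_sum_sawtooth_primes_le (β := β) hκ hγ hE
  obtain ⟨N₃, h₃⟩ := eventually_atTop.mp <| (eventually_excess_eq β hα hc.1).and <|
    tendsto_natCast_atTop_atTop.eventually_ge_atTop (2 * |β| + 2)
  set N₀ := max (max N₁ N₂) N₃
  set B := α ^ (-c⁻¹) * (c⁻¹ * (4 * (1 + |β|)) * ∑' n : ℕ, (n : ℝ) ^ (c⁻¹ - 2))
  have hB : 0 ≤ B := mul_nonneg hκ.le <|
    mul_nonneg (by positivity) (tsum_nonneg fun n ↦ by positivity)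
  refine ⟨N₀, B + C₁ + C₂, fun N q a _ hN ↦ ?_⟩
  have hlarge {p : ℕ} (hp : p ∈ {p ∈ Ioc N₀ N | p.Prime ∧ ((p : ℕ) : ℤ) ≡ a [ZMOD q]}) :
      N₃ ≤ p :=
    (le_max_right _ _).trans (mem_Ioc.mp (mem_filter.mp hp).1).1.le
  rw [sum_congr rfl fun p hp ↦ (h₃ p (hlarge hp)).1, sum_sub_distrib, sum_add_distrib, ← mul_sum]
  have hincr := abs_sum_rpow_add_one_sub_rpow_sub_le (β := β) ⟨hγ₀, hγ.2⟩
    fun p hp ↦ (h₃ p (hlarge hp)).2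
  calc _ ≤ B + C₁ * (N : ℝ) ^ E + C₂ * (N : ℝ) ^ E := by
        refine (abs_sub _ _).trans (add_le_add ((abs_add_le _ _).trans (add_le_add ?_ ?_)) ?_)
        · rw [abs_mul, abs_of_pos hκ]
          exact mul_le_mul_of_nonneg_left hincr hκ.le
        · exact h₁ N₀ N q a (by lia)
        · exact h₂ N₀ N q a (by lia)
    _ ≤ B * (N : ℝ) ^ E + C₁ * (N : ℝ) ^ E + C₂ * (N : ℝ) ^ E := by
        gcongr
        exact le_mul_of_one_le_right hB (one_le_rpow (mod_cast hN) (by linarith))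
    _ = (B + C₁ + C₂) * (N : ℝ) ^ E := by ring

lemma abs_sum_Ioc_zero_filter_le (f : ℕ → ℝ) (P : ℕ → Prop) [DecidablePred P] (M N : ℕ) :
    |∑ n ∈ Ioc 0 N with P n, f n| ≤
      ∑ n ∈ Ioc 0 M, |f n| + |∑ n ∈ Ioc M N with P n, f n| := by
  have hsmall : |∑ n ∈ Ioc 0 (min M N) with P n, f n| ≤ ∑ n ∈ Ioc 0 M, |f n| :=
    (abs_sum_le_sum_abs _ _).trans <| sum_le_sum_of_subset_of_nonneg
      ((filter_subset _ _).trans (Ioc_subset_Ioc_right (min_le_left M N))) fun _ _ _ ↦ abs_nonneg _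
  have hsplit : ∑ n ∈ Ioc 0 N with P n, f n =
      ∑ n ∈ Ioc 0 (min M N) with P n, f n + ∑ n ∈ Ioc M N with P n, f n := by
    simp only [sum_filter]
    rcases le_total M N with h | h
    · rw [min_eq_left h, sum_Ioc_consecutive _ M.zero_le h]
    · rw [min_eq_right h, Ioc_eq_empty_of_le h, sum_empty, add_zero]
  rw [hsplit]
  exact (abs_add_le _ _).trans (add_le_add_left hsmall _)

theorem exists_abs_sum_excess_primes_le {α β c E : ℝ} (hα : 0 < α)
    (hc : c ∈ Set.Ioo 1 (12 / 11)) (hE : c⁻¹ / 5 + 11 / 15 < E) :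
    ∃ C : ℝ, 0 < C ∧ ∀ (N q : ℕ) (a : ℤ) [NeZero q], 1 ≤ N →
      |∑ p ∈ Ioc 0 N with p.Prime ∧ ((p : ℕ) : ℤ) ≡ a [ZMOD q], excess α β c p| ≤
        C * (N : ℝ) ^ E := by
  obtain ⟨N₀, C, hlarge⟩ := exists_abs_sum_Ioc_excess_primes_le (β := β) hα hc hE
  set A := ∑ n ∈ Ioc 0 N₀, |excess α β c n|
  have : 0 ≤ A := sum_nonneg fun n _ ↦ abs_nonneg _
  refine ⟨1 + A + |C|, by positivity, fun N q a _ hN ↦ ?_⟩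
  have hE₀ : 0 ≤ E := by linarith [inv_pos.mpr (one_pos.trans hc.1)]
  calc _ ≤ A + C * (N : ℝ) ^ E :=
        (abs_sum_Ioc_zero_filter_le _ _ N₀ N).trans (add_le_add_right (hlarge N q a hN) A)
    _ ≤ (1 + A) * (N : ℝ) ^ E + |C| * (N : ℝ) ^ E := by
        gcongr
        · exact (lt_one_add A).le.trans <|
            le_mul_of_one_le_right (by positivity) (one_le_rpow (mod_cast hN) hE₀)
        · exact le_abs_self C
    _ = (1 + A + |C|) * (N : ℝ) ^ E := by ring

end Indicator

section PrimeCount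

open Finset Real MeasureTheory

lemma primeCountAP_eq_card {x : ℝ} (hx : 0 ≤ x) (q : ℕ) (a : ℤ) :
    primeCountAP x q a = #{p ∈ Ioc 0 ⌊x⌋₊ | p.Prime ∧ ((p : ℕ) : ℤ) ≡ a [ZMOD q]} := by
  rw [primeCountAP, ← Set.ncard_coe_finset]
  congr 1
  ext p
  simp only [Set.mem_ofPred_eq, coe_filter, mem_Ioc, Nat.le_floor_iff hx]
  have : p.Prime → 0 < p := Nat.Prime.pos
  tauto

lemma primeCountGPS_eq_sum {α β c x : ℝ} (hx : 0 ≤ x) (q : ℕ) (a : ℤ) :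
    (primeCountGPS α β c x q a : ℝ) =
      ∑ p ∈ Ioc 0 ⌊x⌋₊ with p.Prime ∧ ((p : ℕ) : ℤ) ≡ a [ZMOD q],
        (genPiatetskiShapiro α β c).indicator 1 (p : ℤ) := by
  classical
  simp only [Set.indicator_apply, Pi.one_apply]
  rw [sum_boole, filter_filter, primeCountGPS, ← Set.ncard_coe_finset]
  congr 2
  ext p
  simp only [Set.mem_ofPred_eq, coe_filter, mem_Ioc, Nat.le_floor_iff hx]
  have : p.Prime → 0 < p := Nat.Prime.pos
  tauto

lemma sum_rpow_mul_eq_sub_integral {c : ℕ → ℝ} (hc₀ : c 0 = 0) (hc₁ : c 1 = 0) (s x : ℝ) :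
    ∑ n ∈ Icc 0 ⌊x⌋₊, (n : ℝ) ^ s * c n = x ^ s * ∑ n ∈ Icc 0 ⌊x⌋₊, c n -
      s * ∫ u in Set.Ioc 2 x, u ^ (s - 1) * ∑ n ∈ Icc 0 ⌊u⌋₊, c n := by
  have hderiv {u : ℝ} (hu : 2 ≤ u) : HasDerivAt (· ^ s) (s * u ^ (s - 1)) u :=
    hasDerivAt_rpow_const (Or.inl (two_pos.trans_le hu).ne')
  have hcont : ContinuousOn (fun u : ℝ ↦ s * u ^ (s - 1)) (Set.Icc 2 x) :=
    continuousOn_const.mul <| continuousOn_id.rpow_const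
      fun u hu ↦ Or.inl (two_pos.trans_le hu.1).ne'
  rw [sum_mul_eq_sub_integral_mul₁ c hc₀ hc₁ x (fun u hu ↦ (hderiv hu.1).differentiableAt)
    (hcont.integrableOn_Icc.congr_fun (fun u hu ↦ (hderiv hu.1).deriv.symm) measurableSet_Icc),
    ← integral_const_mul]
  congr 1
  refine setIntegral_congr_fun measurableSet_Ioc fun u hu ↦ ?_
  rw [(hderiv hu.1.le).deriv, mul_assoc]

lemma sum_primes_rpow_eq_add_integral (s : ℝ) {x : ℝ} (hx : 2 ≤ x) (q : ℕ) (a : ℤ) :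
    ∑ p ∈ Ioc 0 ⌊x⌋₊ with p.Prime ∧ ((p : ℕ) : ℤ) ≡ a [ZMOD q], (p : ℝ) ^ s =
      x ^ s * primeCountAP x q a -
        s * ∫ u in (2 : ℝ)..x, u ^ (s - 1) * (primeCountAP u q a : ℝ) := by
  set c : ℕ → ℝ := fun n ↦ if n.Prime ∧ (n : ℤ) ≡ a [ZMOD q] then 1 else 0 with hc
  have hc₀ : c 0 = 0 := if_neg fun h ↦ Nat.not_prime_zero h.1
  have hc₁ : c 1 = 0 := if_neg fun h ↦ Nat.not_prime_one h.1
  have hcount {u : ℝ} (hu : 0 ≤ u) : ∑ n ∈ Icc 0 ⌊u⌋₊, c n = primeCountAP u q a := by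
    rw [primeCountAP_eq_card hu, ← add_sum_Ioc_eq_sum_Icc (Nat.zero_le _), hc₀, zero_add, hc,
      sum_boole]
  calc _ = ∑ n ∈ Icc 0 ⌊x⌋₊, (n : ℝ) ^ s * c n := by
        rw [← add_sum_Ioc_eq_sum_Icc (Nat.zero_le _), hc₀, mul_zero, zero_add, sum_filter]
        simp only [hc, mul_ite, mul_one, mul_zero]
    _ = x ^ s * primeCountAP x q a - s * ∫ u in Set.Ioc 2 x, u ^ (s - 1) * primeCountAP u q a := by
        rw [sum_rpow_mul_eq_sub_integral hc₀ hc₁, hcount (by linarith)]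
        congr 2
        refine setIntegral_congr_fun measurableSet_Ioc fun u hu ↦ ?_
        rw [hcount (by linarith [hu.1])]
    _ = _ := by rw [intervalIntegral.integral_of_le hx]

lemma primeCountGPS_sub_eq_sum_excess (α β c : ℝ) {x : ℝ} (hx : 2 ≤ x) (q : ℕ) (a : ℤ) :
    (primeCountGPS α β c x q a : ℝ) -
      (α ^ (-c⁻¹) * c⁻¹ * x ^ (c⁻¹ - 1) * primeCountAP x q a +
        α ^ (-c⁻¹) * c⁻¹ * (1 - c⁻¹) *
          ∫ u in (2 : ℝ)..x, u ^ (c⁻¹ - 2) * (primeCountAP u q a : ℝ)) =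
      ∑ p ∈ Ioc 0 ⌊x⌋₊ with p.Prime ∧ ((p : ℕ) : ℤ) ≡ a [ZMOD q], excess α β c p := by
  have hrpow := sum_primes_rpow_eq_add_integral (c⁻¹ - 1) hx q a
  rw [sub_sub, one_add_one_eq_two] at hrpow
  simp only [excess]
  rw [sum_sub_distrib, ← mul_sum, hrpow, primeCountGPS_eq_sum (by linarith)]
  ring

end PrimeCount

end PiatetskiShapiro

theorem theorem1_general (α β c γ E : ℝ) (hα : 0 < α) (hc₁ : 1 < c) (hc₂ : c < 12 / 11)
    (hγ : γ = c⁻¹) (hE : γ / 5 + 11 / 15 < E) :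
    ∃ C : ℝ, 0 < C ∧ ∀ (q : ℕ) (a : ℤ), 1 ≤ q → ∀ x : ℝ, 2 ≤ x →
      |(primeCountGPS α β c x q a : ℝ)
          - (α ^ (-γ) * γ * x ^ (γ - 1) * (primeCountAP x q a : ℝ)
            + α ^ (-γ) * γ * (1 - γ)
              * ∫ u in (2 : ℝ)..x, u ^ (γ - 2) * (primeCountAP u q a : ℝ))|
        ≤ C * x ^ E := by
  subst hγ
  obtain ⟨C, hC, hsum⟩ :=
    PiatetskiShapiro.exists_abs_sum_excess_primes_le (β := β) hα ⟨hc₁, hc₂⟩ hE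
  refine ⟨C, hC, fun q a hq x hx ↦ ?_⟩
  have : NeZero q := NeZero.of_pos hq
  have hfloor : (⌊x⌋₊ : ℝ) ≤ x := Nat.floor_le (by linarith)
  have hE₀ : 0 ≤ E := by linarith [inv_pos.mpr (one_pos.trans hc₁)]
  rw [PiatetskiShapiro.primeCountGPS_sub_eq_sum_excess α β c hx q a]
  calc _ ≤ C * (⌊x⌋₊ : ℝ) ^ E := hsum ⌊x⌋₊ q a (Nat.le_floor (by norm_num; linarith))
    _ ≤ C * x ^ E := by gcongr

theorem theorem1 (α β c γ ε : ℝ) (hα : 1 ≤ α) (hc₁ : 1 < c) (hc₂ : c < 12 / 11)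
    (hγ : γ = c⁻¹) (hε : 0 < ε) :
    ∃ C : ℝ, 0 < C ∧ ∀ (q : ℕ) (a : ℤ), 1 ≤ q → IsCoprime a (q : ℤ) → ∀ x : ℝ, 2 ≤ x →
      |(primeCountGPS α β c x q a : ℝ)
          - (α ^ (-γ) * γ * x ^ (γ - 1) * (primeCountAP x q a : ℝ)
            + α ^ (-γ) * γ * (1 - γ)
              * ∫ u in (2 : ℝ)..x, u ^ (γ - 2) * (primeCountAP u q a : ℝ))|
        ≤ C * x ^ (7 * γ / 13 + 11 / 26 + ε) := by
  have hγ₀ : 11 / 12 < γ := by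
    rw [hγ, lt_inv_comm₀ (by norm_num) (one_pos.trans hc₁), inv_div]
    exact hc₂
  obtain ⟨C, hC, hbound⟩ := theorem1_general α β c γ (7 * γ / 13 + 11 / 26 + ε)
    (one_pos.trans_le hα) hc₁ hc₂ hγ (by linarith)
  exact ⟨C, hC, fun q a hq _ ↦ hbound q a hq⟩
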